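/- Let $K$ be a number field with an algebraic closure $\overline K$, let $v$ be a finite place of $K$ with valuation ring $O_v$ and residue field $k(v)$, and fix an extension of $v$ to $\overline K$, with residue field $\overline{k(v)}$. A point of $\mathbb P^1(\overline K)$ is reduced modulo $v$ by writing it as $[a:b]$ with $a,b$ integral for the extended valuation and at least one of them a unit, and reducing the coordinates; for $E\subset\mathbb P^1(\overline K)$ let $(E)_v\subset\mathbb P^1(\overline{k(v)})$ be the set of the reductions of its points. Let $\Phi:\mathbb P^1\to\mathbb P^1$ be a morphism of degree $d\ge 2$ defined over $K$, and write $\Phi=[F:G]$ with $F,G\in O_v[X,Y]$ homogeneous of degree $d$, coprime over $K$, at least one of their coefficients being a unit of $O_v$. Let $\Phi_v:\mathbb P^1_{k(v)}\to\mathbb P^1_{k(v)}$ be the morphism defined by $[F_v:G_v]$, where $F_v,G_v$ are obtained by reducing the coefficients and common factors of $F_v$ and $G_v$ are cancelled. Let $\mathcal R_\Phi\subset\mathbb P^1(\overline K)$ be the set of ramification points of $\Phi$ (the points with ramification index at least $2$), so that $\Phi(\mathcal R_\Phi)$ is the set of branch points. Suppose that $\Phi_v$ is separable, i.e. that it is non-constant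 and the extension of function fields $k(v)(x)/k(v)(\Phi_v)$ is separable. Then the following are equivalent: a) $\Phi$ has critically good reduction at $v$, i.e. $\#\mathcal R_\Phi=\#(\mathcal R_\Phi)_v$ and $\#\Phi(\mathcal R_\Phi)=\#(\Phi(\mathcal R_\Phi))_v$; b) $\Phi$ has simple good reduction at $v$, i.e. $\deg\Phi_v=\deg\Phi$, and $\#\Phi(\mathcal R_\Phi)=\#(\Phi(\mathcal R_\Phi))_v$. -/

import Mathlib

open scoped NumberField IntermediateField

noncomputable section

namespace ProjLine

/-- The points `ℙ¹(k)` of the projective line over a field `k`. -/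
abbrev Pt (k : Type*) [Field k] : Type _ := Projectivization k (Fin 2 → k)

/-- Morphisms `ℙ¹ → ℙ¹` over `k`, given by their rational function in the coordinate
`x = X / Y`: a rational function `φ ∈ k(x)`, or the constant map `∞`. -/
abbrev Mor (k : Type*) [Field k] : Type _ := OnePoint (RatFunc k)

section Morphisms

variable {k : Type*} [Field k]

/-- The numerator `f` in lowest terms (`Φ = f / g`; the constant map `∞` is `1 / 0`). -/
def Mor.num (Φ : Mor k) : Polynomial k := OnePoint.elim Φ 1 RatFunc.num

/-- The denominator `g` in lowest terms (`Φ = f / g`; the constant map `∞` is `1 / 0`). -/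
def Mor.den (Φ : Mor k) : Polynomial k := OnePoint.elim Φ 0 RatFunc.denom

/-- The degree `max (deg f) (deg g)` of a morphism `Φ = f / g` in lowest terms. -/
def Mor.deg (Φ : Mor k) : ℕ := max (Mor.num Φ).natDegree (Mor.den Φ).natDegree

/-- `F(X, Y) = Y ^ d f(X / Y)`, where `d = deg Φ`, so that `Φ = [F : G]`. -/
def Mor.formF (Φ : Mor k) : MvPolynomial (Fin 2) k := (Mor.num Φ).homogenize (Mor.deg Φ)

/-- `G(X, Y) = Y ^ d g(X / Y)`, where `d = deg Φ`, so that `Φ = [F : G]`. -/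
def Mor.formG (Φ : Mor k) : MvPolynomial (Fin 2) k := (Mor.den Φ).homogenize (Mor.deg Φ)

theorem Mor.isCoprime (Φ : Mor k) : IsCoprime (Mor.num Φ) (Mor.den Φ) := by
  induction Φ using OnePoint.rec with
  | infty => exact isCoprime_one_left
  | coe φ => exact RatFunc.isCoprime_num_denom φ

theorem coeff_eq_zero_of_homogenize {L : Type*} [Field L] [Algebra k L] (f : Polynomial k) (d : ℕ)
    (p : Fin 2 → L) (hp : p 1 = 0) (h0 : p 0 ≠ 0)
    (h : MvPolynomial.aeval p (f.homogenize d) = 0) : f.coeff d = 0 := by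
  rw [Polynomial.homogenize, map_sum, Finset.sum_eq_single (d, 0)] at h
  · simpa [MvPolynomial.aeval_monomial, Finsupp.update_eq_add_single, Finsupp.prod_add_index',
      pow_add, h0] using h
  · rintro ⟨a, b⟩ hab hne
    have hb : b ≠ 0 := by
      rintro rfl
      simp at hab
      simp [hab] at hne
    simp [MvPolynomial.aeval_monomial, Finsupp.update_eq_add_single, Finsupp.prod_add_index',
      pow_add, hp, hb]
  · simp

theorem aeval_eq_zero_of_homogenize {L : Type*} [Field L] [Algebra k L] (f : Polynomial k) (d : ℕ)
    (hd : f.natDegree ≤ d) (p : Fin 2 → L) (hp : p 1 ≠ 0)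
    (h : MvPolynomial.aeval p (f.homogenize d) = 0) :
    Polynomial.aeval (p 0 / p 1) f = 0 := by
  have key := Polynomial.eval_homogenize (p := f.map (algebraMap k L)) (n := d)
    (by simpa using hd) p hp
  rw [Polynomial.homogenize_map, MvPolynomial.eval_map, ← MvPolynomial.aeval_def, h,
    Polynomial.eval_map, ← Polynomial.aeval_def] at key
  have := pow_ne_zero d hp
  simpa [this] using key.symm

theorem Mor.forms_ne_zero {L : Type*} [Field L] [Algebra k L] (Φ : Mor k) (p : Fin 2 → L)
    (hp : p ≠ 0) :
    (![MvPolynomial.aeval p (Mor.formF Φ), MvPolynomial.aeval p (Mor.formG Φ)] : Fin 2 → L)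
      ≠ 0 := by
  intro h
  have hF : MvPolynomial.aeval p (Mor.formF Φ) = 0 := congrFun h 0
  have hG : MvPolynomial.aeval p (Mor.formG Φ) = 0 := congrFun h 1
  by_cases h1 : p 1 = 0
  · have h0 : p 0 ≠ 0 := fun h0 => hp (by ext i; fin_cases i <;> simp [h0, h1])
    have hf := coeff_eq_zero_of_homogenize _ _ p h1 h0 hF
    have hg := coeff_eq_zero_of_homogenize _ _ p h1 h0 hG
    have hcop := Mor.isCoprime Φ
    rcases max_choice (Mor.num Φ).natDegree (Mor.den Φ).natDegree with hm | hm
    · have hz : Mor.num Φ = 0 := by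
        rw [Mor.deg, hm] at hf
        simpa using hf
      have hu : IsUnit (Mor.den Φ) := by rwa [hz, isCoprime_zero_left] at hcop
      rw [Mor.deg, hm, hz, Polynomial.natDegree_zero] at hg
      rw [Polynomial.eq_C_of_natDegree_eq_zero (Polynomial.natDegree_eq_zero_of_isUnit hu), hg]
        at hu
      simp at hu
    · have hz : Mor.den Φ = 0 := by
        rw [Mor.deg, hm] at hg
        simpa using hg
      have hu : IsUnit (Mor.num Φ) := by rwa [hz, isCoprime_zero_right] at hcop
      rw [Mor.deg, hm, hz, Polynomial.natDegree_zero] at hf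
      rw [Polynomial.eq_C_of_natDegree_eq_zero (Polynomial.natDegree_eq_zero_of_isUnit hu), hf]
        at hu
      simp at hu
  · have hf := aeval_eq_zero_of_homogenize _ _ (le_max_left _ _) p h1 hF
    have hg := aeval_eq_zero_of_homogenize _ _ (le_max_right _ _) p h1 hG
    obtain ⟨a, b, hab⟩ := Mor.isCoprime Φ
    have := congrArg (Polynomial.aeval (p 0 / p 1)) hab
    simp [hf, hg] at this

/-- The map `[p₀ : p₁] ↦ [F(p₀, p₁) : G(p₀, p₁)]` on `L`-points, for an extension `L / k`. -/
def Mor.map {L : Type*} [Field L] [Algebra k L] (Φ : Mor k) (P : Pt L) : Pt L :=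
  Projectivization.mk L _ (Mor.forms_ne_zero Φ P.rep P.rep_nonzero)

/-- The ramification index `e_P(Φ)` at an `L`-point `P = [p₀ : p₁]`: the multiplicity of the
linear form `p₁ X - p₀ Y`, which defines `P`, in the form `G(P) F - F(P) G`, which defines the
fibre of `Φ` through `P`. -/
def Mor.ramificationIdx {L : Type*} [Field L] [Algebra k L] (Φ : Mor k) (P : Pt L) : ℕ∞ :=
  emultiplicity
    (MvPolynomial.C (P.rep 1) * MvPolynomial.X 0 - MvPolynomial.C (P.rep 0) * MvPolynomial.X 1)
    (MvPolynomial.C (MvPolynomial.aeval P.rep (Mor.formG Φ)) *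
        MvPolynomial.map (algebraMap k L) (Mor.formF Φ) -
      MvPolynomial.C (MvPolynomial.aeval P.rep (Mor.formF Φ)) *
        MvPolynomial.map (algebraMap k L) (Mor.formG Φ))

/-- The set `R_Φ` of ramification points of `Φ` among the `L`-points of the line. -/
def Mor.ramificationSet (L : Type*) [Field L] [Algebra k L] (Φ : Mor k) : Set (Pt L) :=
  {P | 1 < Mor.ramificationIdx Φ P}

/-- The set `Φ(R_Φ)` of branch points. -/
def Mor.branchSet (L : Type*) [Field L] [Algebra k L] (Φ : Mor k) : Set (Pt L) :=
  Mor.map Φ '' Mor.ramificationSet L Φ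

/-- `Φ` is separable: the extension of function fields `k(x) / k(Φ)` is (algebraic and)
separable. A constant map is not separable. -/
def Mor.IsSeparable (Φ : Mor k) : Prop :=
  OnePoint.elim Φ False (fun φ => Algebra.IsSeparable k⟮φ⟯ (RatFunc k))

end Morphisms

section Reduction

variable {L : Type*} [Field L] (A : ValuationSubring L)

/-- A finite family in `L` that is not identically zero can be rescaled so that all members are
in `A` and one of them is a unit of `A`. -/
theorem exists_primitive {ι : Type*} (s : Finset ι) (x : ι → L) (hx : ∃ i ∈ s, x i ≠ 0) :
    ∃ c : L, c ≠ 0 ∧ (∀ i ∈ s, c * x i ∈ A) ∧ ∃ i ∈ s, A.valuation (c * x i) = 1 := by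
  obtain ⟨j, hj, hxj⟩ := hx
  obtain ⟨i, hi, hmax⟩ := s.exists_max_image (fun i => A.valuation (x i)) ⟨j, hj⟩
  have hi0 : x i ≠ 0 := by
    intro h
    have := hmax j hj
    simp [h, hxj] at this
  refine ⟨(x i)⁻¹, inv_ne_zero hi0, fun l hl => ?_, i, hi, by simp [hi0]⟩
  rw [← A.valuation_le_one_iff, map_mul, map_inv₀]
  have hv : A.valuation (x i) ≠ 0 := by simpa using hi0
  exact (mul_le_mul_right (hmax l hl) _).trans (by rw [inv_mul_cancel₀ hv])

/-- Every point of `ℙ¹(L)` has coordinates in `A`, at least one of which is a unit. -/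
theorem exists_primitive_coords (P : Pt L) :
    ∃ a : Fin 2 → A, (∃ i, IsUnit (a i)) ∧
      ∃ h : (fun i => (a i : L)) ≠ 0, Projectivization.mk L (fun i => (a i : L)) h = P := by
  obtain ⟨c, hc, hA, i, -, hi⟩ := exists_primitive A Finset.univ P.rep
    (by simpa [Function.ne_iff] using Function.ne_iff.mp P.rep_nonzero)
  refine ⟨fun i => ⟨c * P.rep i, hA i (Finset.mem_univ i)⟩, ⟨i, ?_⟩, ?_, ?_⟩
  · exact (A.valuation_eq_one_iff _).mpr hi
  · intro h
    have := congrFun h i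
    simp only [Pi.zero_apply] at this
    simp [this] at hi
  · conv_rhs => rw [← P.mk_rep]
    rw [Projectivization.mk_eq_mk_iff']
    exact ⟨c, rfl⟩

theorem residue_ne_zero {a : Fin 2 → A} (h : ∃ i, IsUnit (a i)) :
    (fun i => IsLocalRing.residue A (a i)) ≠ 0 := by
  obtain ⟨i, hi⟩ := h
  exact fun h0 => (hi.map (IsLocalRing.residue A)).ne_zero (congrFun h0 i)

/-- Reduction of points `ℙ¹(L) → ℙ¹(κ)`, where `κ` is the residue field of `A`: write the point
with coordinates in `A`, one of them a unit, and reduce the coordinates. -/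
def reducePt (P : Pt L) : Pt (IsLocalRing.ResidueField A) :=
  Projectivization.mk _ _ (residue_ne_zero A (exists_primitive_coords A P).choose_spec.1)

/-- Two systems of coordinates in `A` with a unit among them reduce to the same point. -/
theorem mk_residue_eq {a b : Fin 2 → A} (ha : ∃ i, IsUnit (a i)) (hb : ∃ i, IsUnit (b i))
    (h : (fun i => (a i : L)) ≠ 0) (h' : (fun i => (b i : L)) ≠ 0)
    (hab : Projectivization.mk L (fun i => (b i : L)) h' =
      Projectivization.mk L (fun i => (a i : L)) h) :
    Projectivization.mk (IsLocalRing.ResidueField A) _ (residue_ne_zero A hb) =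
      Projectivization.mk _ _ (residue_ne_zero A ha) := by
  rw [Projectivization.mk_eq_mk_iff'] at hab ⊢
  obtain ⟨c, hc⟩ := hab
  have hc' : ∀ i, c * (a i : L) = b i := fun i => congrFun hc i
  have hcA : c ∈ A := by
    obtain ⟨i, u, hu⟩ := ha
    have : c = ((b i * (↑u⁻¹ : A) : A) : L) := by
      have h1 : ((u : A) : L) * ((↑u⁻¹ : A) : L) = 1 := by
        exact_mod_cast congrArg (Subtype.val) u.mul_inv
      push_cast
      rw [← hc' i, ← hu, mul_assoc, h1, mul_one]
    rw [this]
    exact Subtype.property _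
  refine ⟨IsLocalRing.residue A ⟨c, hcA⟩, funext fun i => ?_⟩
  simp only [Pi.smul_apply, smul_eq_mul, ← map_mul]
  exact congrArg _ (Subtype.ext (hc' i))

/-- The reduction of a point does not depend on the choice of the coordinates. -/
theorem reducePt_mk (a : Fin 2 → A) (ha : ∃ i, IsUnit (a i)) (h : (fun i => (a i : L)) ≠ 0) :
    reducePt A (Projectivization.mk L (fun i => (a i : L)) h) =
      Projectivization.mk _ _ (residue_ne_zero A ha) := by
  obtain ⟨hb, hb0, hbe⟩ :=
    (exists_primitive_coords A (Projectivization.mk L (fun i => (a i : L)) h)).choose_spec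
  exact mk_residue_eq A ha hb h hb0 hbe

/-- `f / g` is a reduced form of `Φ`: `f` and `g` have coefficients in `A`, not all of them
non-units, and are obtained from the numerator and the denominator of `Φ` by a common
nonzero factor. -/
structure IsReducedForm (Φ : Mor L) (f g : Polynomial A) : Prop where
  exists_scalar : ∃ c : L, c ≠ 0 ∧
    f.map (algebraMap A L) = Polynomial.C c * Mor.num Φ ∧
    g.map (algebraMap A L) = Polynomial.C c * Mor.den Φ
  primitive : ∃ i, IsUnit (f.coeff i) ∨ IsUnit (g.coeff i)

theorem exists_isReducedForm (Φ : Mor L) :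
    ∃ fg : Polynomial A × Polynomial A, IsReducedForm A Φ fg.1 fg.2 := by
  have hne : ∃ i ∈ (Finset.range (Mor.deg Φ + 1)).disjSum (Finset.range (Mor.deg Φ + 1)),
      Sum.elim (Mor.num Φ).coeff (Mor.den Φ).coeff i ≠ 0 := by
    by_contra! hcon
    have hf : Mor.num Φ = 0 := by
      ext i
      by_cases hi : i < Mor.deg Φ + 1
      · exact hcon (Sum.inl i) (by simpa using hi)
      · exact Polynomial.coeff_eq_zero_of_natDegree_lt
          (lt_of_le_of_lt (le_max_left _ _) (not_lt.mp hi))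
    have hg : Mor.den Φ = 0 := by
      ext i
      by_cases hi : i < Mor.deg Φ + 1
      · exact hcon (Sum.inr i) (by simpa using hi)
      · exact Polynomial.coeff_eq_zero_of_natDegree_lt
          (lt_of_le_of_lt (le_max_right _ _) (not_lt.mp hi))
    have := Mor.isCoprime Φ
    rw [hf, hg, isCoprime_zero_left] at this
    exact not_isUnit_zero this
  obtain ⟨c, hc, hA, i, hi, hu⟩ := exists_primitive A _ _ hne
  have lift : ∀ q : Polynomial L, (∀ j, c * q.coeff j ∈ A) →
      ∃ r : Polynomial A, r.map (algebraMap A L) = Polynomial.C c * q := by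
    intro q hq
    have : Polynomial.C c * q ∈ Polynomial.lifts (algebraMap A L) := by
      rw [Polynomial.lifts_iff_coeff_lifts]
      intro j
      exact ⟨⟨c * q.coeff j, hq j⟩, by rw [Polynomial.coeff_C_mul]; rfl⟩
    exact (Polynomial.mem_lifts _).mp this
  have hAf : ∀ j, c * (Mor.num Φ).coeff j ∈ A := by
    intro j
    by_cases hj : j < Mor.deg Φ + 1
    · exact hA (Sum.inl j) (by simpa using hj)
    · rw [Polynomial.coeff_eq_zero_of_natDegree_lt
        (lt_of_le_of_lt (le_max_left _ _) (not_lt.mp hj)), mul_zero]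
      exact A.zero_mem
  have hAg : ∀ j, c * (Mor.den Φ).coeff j ∈ A := by
    intro j
    by_cases hj : j < Mor.deg Φ + 1
    · exact hA (Sum.inr j) (by simpa using hj)
    · rw [Polynomial.coeff_eq_zero_of_natDegree_lt
        (lt_of_le_of_lt (le_max_right _ _) (not_lt.mp hj)), mul_zero]
      exact A.zero_mem
  obtain ⟨f, hf⟩ := lift _ hAf
  obtain ⟨g, hg⟩ := lift _ hAg
  refine ⟨(f, g), ⟨c, hc, hf, hg⟩, ?_⟩
  rcases i with i | i
  · refine ⟨i, Or.inl ((A.valuation_eq_one_iff _).mpr ?_)⟩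
    have := congrArg (fun q => Polynomial.coeff q i) hf
    simp only [Polynomial.coeff_map, Polynomial.coeff_C_mul] at this
    exact (congrArg A.valuation this).trans hu
  · refine ⟨i, Or.inr ((A.valuation_eq_one_iff _).mpr ?_)⟩
    have := congrArg (fun q => Polynomial.coeff q i) hg
    simp only [Polynomial.coeff_map, Polynomial.coeff_C_mul] at this
    exact (congrArg A.valuation this).trans hu

open Classical in
/-- The morphism `f / g` for polynomials `f`, `g` over a field that are not both zero. -/
def Mor.ofPair {k : Type*} [Field k] (f g : Polynomial k) : Mor k :=
  if g = 0 then OnePoint.infty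
  else OnePoint.some (algebraMap (Polynomial k) (RatFunc k) f / algebraMap _ _ g)

/-- The reduced morphism `Φ_v = f_v / g_v` over the residue field, where `f / g` is a reduced
form of `Φ` (which is unique up to a common factor that is a unit of `A`). Common factors of
`f_v` and `g_v` cancel. -/
def Mor.reduce (Φ : Mor L) : Mor (IsLocalRing.ResidueField A) :=
  Mor.ofPair ((exists_isReducedForm A Φ).choose.1.map (IsLocalRing.residue A))
    ((exists_isReducedForm A Φ).choose.2.map (IsLocalRing.residue A))

/-- Simple good reduction: the reduced morphism has the same degree. -/
def Mor.SimpleGoodReduction (Φ : Mor L) : Prop := Mor.deg (Mor.reduce A Φ) = Mor.deg Φ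

/-- The cardinality of a set of points is preserved by reduction. -/
def NonsingularMod (E : Set (Pt L)) : Prop := E.encard = (reducePt A '' E).encard

end Reduction

/-- Critically good reduction of a morphism over `K`, with respect to a valuation ring `w` of an
algebraic closure of `K`. -/
def Mor.CriticallyGoodReduction {K Kbar : Type*} [Field K] [Field Kbar] [Algebra K Kbar]
    (w : ValuationSubring Kbar) (Φ : Mor K) : Prop :=
  NonsingularMod w (Mor.ramificationSet Kbar Φ) ∧ NonsingularMod w (Mor.branchSet Kbar Φ)

/-- The valuation ring `O_v` of a number field `K` at a finite place `v`. -/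
def valuationRing {K : Type*} [Field K] [NumberField K]
    (v : IsDedekindDomain.HeightOneSpectrum (𝓞 K)) : ValuationSubring K :=
  (v.valuation K).valuationSubring

end ProjLine

end

/-! Work over the valuation ring `A` of the algebraically closed field, one residue disc at a time.
With a parameter t in the maximal ideal, Φ = f/g for polynomials f, g over `A`, and the ramification
points in the disc are the zeros of the Wronskian W = f'g - fg'. Separability of the reduction
enters as W̄ ≠ 0, so W has exactly ord₀ W̄ zeros in the disc, with multiplicity.

Suppose that the disc contains r ≥ 1 ramification points, all with the same image a. Exchanging f
and g if necessary, a lies in `A`; put H = f - ag, whose Wronskian with g is again W. In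
characteristic zero H vanishes at each of the r points to order one more than W, so ord₀ W̄ + r ≤
ord₀ H̄. Conversely W̄ is the Wronskian of H̄ and ḡ, so ord₀ W̄ ≥ ord₀ H̄ - 1, without the loss of 1
if ḡ(0) = 0. Hence r = 1 and ḡ(0) ≠ 0 (`ramified_subsingleton_aux`). A common zero of f̄ and ḡ would
itself force a zero of W in the disc, so it is excluded even when r is not assumed positive
(`ramified_subsingleton`).

For a) ⇒ b), each disc has at most one ramification point, so the condition on images is automatic;
the reduced forms then have no common zero, which means that the degree is kept
(`deg_ofPair_eq_iff`). For b) ⇒ a), good reduction makes Φ commute with reduction, so ramification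
points in one disc have branch points with equal reductions; these coincide by hypothesis, and the
local result leaves one point per disc. Both directions meet in `IsModel.nonsingularMod_iff`. -/

noncomputable section

namespace ProjLine

open Polynomial IsLocalRing

/-! ### Zeros in a residue disc and the Wronskian count. -/

section LocalTheory

variable {L : Type*} [Field L] {A : ValuationSubring L}

/-- A polynomial over a valuation ring of an algebraically closed field whose reduction is nonzero
but vanishes at `0` has a root in the maximal ideal. -/
theorem exists_root_residue_eq_zero [IsAlgClosed L] (H : A[X]) (hH : H.map (residue A) ≠ 0)
    (h0 : (H.map (residue A)).eval 0 = 0) : ∃ t : A, residue A t = 0 ∧ H.eval t = 0 := by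
  by_contra! hcon
  have hinj : Function.Injective (algebraMap A L) := Subtype.val_injective
  have hH0 : H ≠ 0 := by rintro rfl; simp at hH
  set P := H.map (algebraMap A L) with hP
  have hP0 : P ≠ 0 := (Polynomial.map_ne_zero_iff hinj).mpr hH0
  -- A root x outside the maximal ideal has x⁻¹ ∈ A, so X - x = -x(1 - x⁻¹X) is a scalar times a
  -- polynomial over `A` with constant term 1.
  have key : ∀ s : Multiset L, (∀ x ∈ s, x ∈ P.roots) → ∃ (Q : A[X]) (c : L),
      (s.map (fun x => X - C x)).prod = C c * Q.map (algebraMap A L) ∧ Q.eval 0 = 1 := by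
    intro s
    induction s using Multiset.induction with
    | empty => exact fun _ => ⟨1, 1, by simp, by simp⟩
    | cons x s ih =>
      intro hs
      obtain ⟨Q, c, hQ, hQ0⟩ := ih fun y hy => hs y (Multiset.mem_cons_of_mem hy)
      have hx : P.eval x = 0 := (mem_roots'.mp (hs x (Multiset.mem_cons_self x s))).2
      have hxA : ∀ y : A, (y : L) = x → residue A y ≠ 0 := by
        rintro y rfl hy
        refine hcon y hy (hinj ?_)
        rw [map_zero, ← hx, hP]
        exact (eval_map_apply _ _).symm
      have hx0 : x ≠ 0 := by
        rintro rfl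
        exact hxA 0 rfl (map_zero _)
      have hinv : x⁻¹ ∈ A := by
        rcases A.mem_or_inv_mem x with h | h
        · have hu : IsUnit (⟨x, h⟩ : A) := by
            by_contra hu
            exact hxA ⟨x, h⟩ rfl ((residue_eq_zero_iff _).mpr hu)
          obtain ⟨u, hu⟩ := hu
          have h1 : x * ((↑u⁻¹ : A) : L) = 1 := by
            have : (u : A) * (↑u⁻¹ : A) = 1 := u.mul_inv
            rw [hu] at this
            exact congrArg Subtype.val this
          rw [inv_eq_of_mul_eq_one_right h1]
          exact Subtype.property _
        · exact h
      refine ⟨(1 - C ⟨x⁻¹, hinv⟩ * X) * Q, -x * c, ?_, by simp [hQ0]⟩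
      rw [Multiset.map_cons, Multiset.prod_cons, hQ, Polynomial.map_mul, Polynomial.map_sub,
        Polynomial.map_mul, Polynomial.map_C, Polynomial.map_X, Polynomial.map_one]
      have h1 : (C x : L[X]) * C (algebraMap A L ⟨x⁻¹, hinv⟩) = 1 := by
        rw [← C_mul, ← C_1]
        exact congrArg C (mul_inv_cancel₀ hx0)
      rw [C_mul, C_neg]
      linear_combination (-C c * X * Q.map (algebraMap A L)) * h1
  obtain ⟨Q, c, hQ, hQ0⟩ := key P.roots fun _ h => h
  have hPQ : P = C (P.leadingCoeff * c) * Q.map (algebraMap A L) := by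
    rw [C_mul, mul_assoc, ← hQ]
    exact (IsAlgClosed.splits P).eq_prod_roots
  -- Constant terms identify the scalar as H(0), so H = H(0)·Q over `A`; as H(0) reduces to 0, so
  -- does all of H.
  have hcoef : algebraMap A L (H.eval 0) = P.leadingCoeff * c := by
    have : (Q.map (algebraMap A L)).eval (algebraMap A L 0) = 1 := by
      rw [eval_map_apply, hQ0, map_one]
    rw [map_zero] at this
    rw [← eval_map_apply, ← hP, map_zero]
    conv_lhs => rw [hPQ]
    rw [eval_mul, eval_C, this, mul_one]
  have hHQ : H = C (H.eval 0) * Q := by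
    apply Polynomial.map_injective _ hinj
    rw [Polynomial.map_mul, Polynomial.map_C, hcoef, ← hPQ]
  apply hH
  rw [hHQ, Polynomial.map_mul, Polynomial.map_C]
  have : residue A (H.eval 0) = 0 := by
    rw [← h0, ← eval_map_apply, map_zero]
  rw [this, C_0, zero_mul]

/-- The roots in the maximal ideal, with multiplicity, can be split off. -/
theorem exists_eq_prod_mul [IsAlgClosed L] (n : ℕ) (H : A[X]) (hn : H.natDegree ≤ n)
    (hH : H.map (residue A) ≠ 0) :
    ∃ (M : Multiset A) (R : A[X]), (∀ t ∈ M, residue A t = 0) ∧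
      H = (M.map fun t => X - C t).prod * R ∧ (R.map (residue A)).eval 0 ≠ 0 := by
  induction n generalizing H with
  | zero =>
    refine ⟨0, H, by simp, by simp, fun h0 => ?_⟩
    rw [eq_C_of_natDegree_le_zero hn] at h0 hH
    simp_all
  | succ n ih =>
    by_cases h0 : (H.map (residue A)).eval 0 = 0
    · obtain ⟨t, ht, htH⟩ := exists_root_residue_eq_zero H hH h0
      obtain ⟨Q, rfl⟩ := dvd_iff_isRoot.mpr htH
      have hQ : Q.map (residue A) ≠ 0 := by
        intro h
        simp [h] at hH
      have hQ0 : Q ≠ 0 := by rintro rfl; simp at hQ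
      have hdeg : Q.natDegree ≤ n := by
        rw [natDegree_mul (X_sub_C_ne_zero t) hQ0, natDegree_X_sub_C] at hn
        omega
      obtain ⟨M, R, hM, hMR, hR⟩ := ih Q hdeg hQ
      refine ⟨t ::ₘ M, R, ?_, ?_, hR⟩
      · intro y hy
        rcases Multiset.mem_cons.mp hy with rfl | hy
        exacts [ht, hM y hy]
      · rw [hMR, Multiset.map_cons, Multiset.prod_cons, mul_assoc]
    · exact ⟨0, H, by simp, by simp, h0⟩

theorem rootMultiplicity_prod_mul {R : Type*} [CommRing R] [IsDomain R] [DecidableEq R]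
    (M : Multiset R) (Q : R[X]) (t : R) (hQ : Q.eval t ≠ 0) :
    ((M.map fun t => X - C t).prod * Q).rootMultiplicity t = M.count t := by
  have hQ0 : Q ≠ 0 := by rintro rfl; simp at hQ
  have hM : (M.map fun t => X - C t).prod ≠ 0 :=
    (monic_multisetProd_X_sub_C M).ne_zero
  rw [rootMultiplicity_mul (mul_ne_zero hM hQ0), rootMultiplicity_eq_zero (p := Q) hQ, add_zero,
    ← count_roots, roots_multiset_prod_X_sub_C]

/-- The order of vanishing at `0` of the reduction is the number of roots in the maximal ideal. -/
theorem exists_multiset_count_eq [IsAlgClosed L] [DecidableEq A] (H : A[X])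
    (hH : H.map (residue A) ≠ 0) :
    ∃ M : Multiset A, (∀ t ∈ M, residue A t = 0) ∧
      (∀ t, residue A t = 0 → H.rootMultiplicity t = M.count t) ∧
      (H.map (residue A)).rootMultiplicity 0 = M.card := by
  classical
  obtain ⟨M, R, hM, rfl, hR⟩ := exists_eq_prod_mul _ H le_rfl hH
  refine ⟨M, hM, fun t ht => ?_, ?_⟩
  · refine rootMultiplicity_prod_mul M R t fun h => hR ?_
    rw [← ht, eval_map_apply, h, map_zero, ht]
  · have h1 : ((M.map fun t => X - C t).prod * R).map (residue A) =
        ((M.map (residue A)).map fun t => X - C t).prod * R.map (residue A) := by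
      rw [Polynomial.map_mul, Polynomial.map_multiset_prod, Multiset.map_map, Multiset.map_map]
      simp
    rw [h1, rootMultiplicity_prod_mul _ _ _ hR, Multiset.count_eq_card.mpr, Multiset.card_map]
    intro x hx
    obtain ⟨t, ht, rfl⟩ := Multiset.mem_map.mp hx
    exact (hM t ht).symm

/-- `T` may miss roots in the disc, hence only an inequality. It serves for f - ag, whose unramified
zeros are not tracked; the equality that follows serves for the Wronskian. -/
theorem sum_rootMultiplicity_le [IsAlgClosed L] (H : A[X]) (hH : H.map (residue A) ≠ 0)
    (T : Finset A) (hT : ∀ t ∈ T, residue A t = 0) :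
    ∑ t ∈ T, H.rootMultiplicity t ≤ (H.map (residue A)).rootMultiplicity 0 := by
  classical
  obtain ⟨M, -, hM, hcard⟩ := exists_multiset_count_eq H hH
  rw [hcard, Finset.sum_congr rfl fun t ht => hM t (hT t ht)]
  calc ∑ t ∈ T, M.count t ≤ ∑ t ∈ T ∪ M.toFinset, M.count t :=
        Finset.sum_le_sum_of_subset Finset.subset_union_left
    _ = M.card := Multiset.sum_count_eq_card fun a ha => by simp [ha]

theorem sum_rootMultiplicity_eq [IsAlgClosed L] (H : A[X]) (hH : H.map (residue A) ≠ 0)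
    (T : Finset A) (hT : ∀ t, t ∈ T ↔ residue A t = 0 ∧ H.eval t = 0) :
    ∑ t ∈ T, H.rootMultiplicity t = (H.map (residue A)).rootMultiplicity 0 := by
  classical
  have hH0 : H ≠ 0 := by rintro rfl; simp at hH
  obtain ⟨M, hM0, hM, hcard⟩ := exists_multiset_count_eq H hH
  rw [hcard, Finset.sum_congr rfl fun t ht => hM t ((hT t).mp ht).1]
  refine Multiset.sum_count_eq_card fun a ha => (hT a).mpr ⟨hM0 a ha, ?_⟩
  refine (rootMultiplicity_pos hH0).mp ?_
  rw [hM a (hM0 a ha)]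
  exact Multiset.count_pos.mpr ha

/-- The Wronskian of `f` and `g`; its zeros are the ramification points of `f / g`. -/
def wr {R : Type*} [CommRing R] (f g : R[X]) : R[X] := derivative f * g - f * derivative g

theorem wr_map {R S : Type*} [CommRing R] [CommRing S] (φ : R →+* S) (f g : R[X]) :
    (wr f g).map φ = wr (f.map φ) (g.map φ) := by
  simp [wr]

theorem wr_swap {R : Type*} [CommRing R] (f g : R[X]) : wr g f = -wr f g := by
  simp only [wr]; ring

/-- Translating the target coordinate does not move the ramification, so a branch value may be moved
to 0. -/
theorem wr_sub_C_mul {R : Type*} [CommRing R] (f g : R[X]) (a : R) :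
    wr (f - C a * g) g = wr f g := by
  simp only [wr, derivative_sub, derivative_mul, derivative_C]; ring

/-- Differentiation loses at most one order in any characteristic; this half is the one available
over the residue field. -/
theorem pow_dvd_wr {R : Type*} [CommRing R] (n : ℕ) (t : R) (f g : R[X])
    (h : (X - C t) ^ (n + 1) ∣ f) : (X - C t) ^ n ∣ wr f g := by
  obtain ⟨u, rfl⟩ := h
  refine ⟨(C ((n : R) + 1) * u + (X - C t) * derivative u) * g - (X - C t) * u * derivative g, ?_⟩
  simp only [wr, derivative_mul, derivative_X_sub_C_pow]
  simp
  ring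

/-- The leading term of the Wronskian at t is (n + 1)·u(t)·g(t), and characteristic zero keeps the
factor n + 1 from vanishing. This is where wild behaviour could only appear after reduction. -/
theorem rootMultiplicity_wr {R : Type*} [CommRing R] [IsDomain R] [CharZero R] (t : R) (f g : R[X])
    (hf0 : f ≠ 0) (hf : f.eval t = 0) (hg : g.eval t ≠ 0) :
    (wr f g).rootMultiplicity t + 1 = f.rootMultiplicity t := by
  obtain ⟨u, hu, hdvd⟩ := exists_eq_pow_rootMultiplicity_mul_and_not_dvd f hf0 t
  obtain ⟨n, hn⟩ := Nat.exists_eq_add_of_lt ((rootMultiplicity_pos hf0).mpr hf)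
  rw [zero_add] at hn
  rw [hn] at hu ⊢
  have hut : u.eval t ≠ 0 := fun h => hdvd (dvd_iff_isRoot.mpr h)
  have hw : wr f g = (X - C t) ^ n * ((C ((n : R) + 1) * u + (X - C t) * derivative u) * g
      - (X - C t) * u * derivative g) := by
    rw [hu]
    simp only [wr, derivative_mul, derivative_X_sub_C_pow]
    simp
    ring
  have hev : (((C ((n : R) + 1) * u + (X - C t) * derivative u) * g
      - (X - C t) * u * derivative g)).eval t ≠ 0 := by
    simp only [eval_sub, eval_mul, eval_add, eval_C, eval_X, sub_self, zero_mul, add_zero, sub_zero]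
    exact mul_ne_zero (mul_ne_zero (Nat.cast_add_one_ne_zero n) hut) hg
  have h0 : wr f g ≠ 0 := by
    rw [hw]
    refine mul_ne_zero (pow_ne_zero _ (X_sub_C_ne_zero t)) ?_
    intro h
    rw [h, eval_zero] at hev
    exact hev rfl
  rw [hw] at h0 ⊢
  rw [rootMultiplicity_mul h0, rootMultiplicity_X_sub_C_pow, rootMultiplicity_eq_zero hev]

/-- The order count of the proof, for a disc whose common branch value f(t₀)/g(t₀) is integral. -/
theorem ramified_subsingleton_aux [IsAlgClosed L] [CharZero L] (f g : A[X])
    (hW : (wr f g).map (residue A) ≠ 0)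
    (hcop : ∀ t, f.eval t = 0 → g.eval t ≠ 0)
    (himg : ∀ t t', residue A t = 0 → residue A t' = 0 → (wr f g).eval t = 0 →
      (wr f g).eval t' = 0 → f.eval t * g.eval t' = f.eval t' * g.eval t)
    (t₀ : A) (ht₀ : residue A t₀ = 0) (hWt₀ : (wr f g).eval t₀ = 0)
    (hdvd : g.eval t₀ ∣ f.eval t₀) :
    (∀ t, residue A t = 0 → (wr f g).eval t = 0 → t = t₀) ∧
      residue A (g.eval t₀) ≠ 0 := by
  classical
  have hchar : CharZero A := ⟨fun m n h => by
    have := congrArg (algebraMap A L) h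
    simpa using this⟩
  obtain ⟨a, ha⟩ := hdvd
  have hg0 : g.eval t₀ ≠ 0 := by
    intro h
    refine hcop t₀ ?_ h
    rw [ha, h, zero_mul]
  have hval : ∀ t, residue A t = 0 → (wr f g).eval t = 0 → f.eval t = a * g.eval t := by
    intro t ht hWt
    have := himg t₀ t ht₀ ht hWt₀ hWt
    rw [ha] at this
    apply mul_right_cancel₀ hg0
    linear_combination -this
  have hgt : ∀ t, residue A t = 0 → (wr f g).eval t = 0 → g.eval t ≠ 0 := by
    intro t ht hWt h
    refine hcop t ?_ h
    rw [hval t ht hWt, h, mul_zero]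
  set H := f - C a * g with hHdef
  have hWH : wr H g = wr f g := wr_sub_C_mul f g a
  have hH : H.map (residue A) ≠ 0 := by
    intro h
    rw [← hWH, wr_map, h] at hW
    simp [wr] at hW
  have hH0 : H ≠ 0 := by
    intro h
    simp [h] at hH
  have hW0 : wr f g ≠ 0 := by
    intro h
    simp [h] at hW
  have hev : ∀ t, residue A t = 0 → (wr f g).eval t = 0 → H.eval t = 0 := by
    intro t ht hWt
    simp [hHdef, hval t ht hWt]
  set T := (wr f g).roots.toFinset.filter (fun t => residue A t = 0) with hTdef
  have hT : ∀ t, t ∈ T ↔ residue A t = 0 ∧ (wr f g).eval t = 0 := by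
    intro t
    simp [hTdef, hW0, and_comm]
  have hN := sum_rootMultiplicity_eq (wr f g) hW T hT
  have hn := sum_rootMultiplicity_le H hH T fun t ht => ((hT t).mp ht).1
  have hsum : ∑ t ∈ T, H.rootMultiplicity t = ∑ t ∈ T, (wr f g).rootMultiplicity t + T.card := by
    rw [Finset.card_eq_sum_ones, ← Finset.sum_add_distrib]
    refine Finset.sum_congr rfl fun t ht => ?_
    obtain ⟨h1, h2⟩ := (hT t).mp ht
    rw [← hWH, rootMultiplicity_wr t H g hH0 (hev t h1 h2) (hgt t h1 h2)]
  have ht₀T : t₀ ∈ T := (hT t₀).mpr ⟨ht₀, hWt₀⟩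
  have hTpos : 1 ≤ T.card := Finset.card_pos.mpr ⟨t₀, ht₀T⟩
  rw [hsum, hN] at hn
  have hWmap : (wr f g).map (residue A) = wr (H.map (residue A)) (g.map (residue A)) := by
    rw [← hWH, wr_map]
  obtain ⟨m, hm⟩ : ∃ m, (H.map (residue A)).rootMultiplicity 0 = m + 1 :=
    ⟨(H.map (residue A)).rootMultiplicity 0 - 1, by omega⟩
  have hdvdH : (X - C 0) ^ (m + 1) ∣ H.map (residue A) := by
    rw [← hm]
    exact pow_rootMultiplicity_dvd _ _
  have hm1 : m ≤ ((wr f g).map (residue A)).rootMultiplicity 0 := by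
    rw [le_rootMultiplicity_iff hW, hWmap]
    exact pow_dvd_wr m 0 _ _ hdvdH
  refine ⟨fun t ht hWt => ?_, fun hres => ?_⟩
  · exact Finset.card_le_one.mp (by omega) t ((hT t).mpr ⟨ht, hWt⟩) t₀ ht₀T
  -- If ḡ(0) = 0, the term H̄'ḡ regains the order lost by differentiating, and H̄ḡ' never lost it;
  -- this contradicts N + #T ≤ m + 1 with `T` nonempty.
  · have hm2 : m + 1 ≤ ((wr f g).map (residue A)).rootMultiplicity 0 := by
      rw [le_rootMultiplicity_iff hW, hWmap]
      have hgdvd : (X - C 0) ∣ g.map (residue A) := by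
        rw [dvd_iff_isRoot, IsRoot, ← ht₀, eval_map_apply, hres, ht₀]
      have h1 : (X - C 0) ^ (m + 1) ∣ derivative (H.map (residue A)) * g.map (residue A) := by
        rw [pow_succ]
        refine mul_dvd_mul ?_ hgdvd
        -- The Wronskian with 1 is the derivative.
        have := pow_dvd_wr m 0 _ 1 hdvdH
        simpa [wr] using this
      exact dvd_sub h1 (hdvdH.mul_right _)
    omega

/-- If all ramification points in a residue disc have the same image, then there is at most one of
them, and the reductions of `f` and `g` do not both vanish. -/
theorem ramified_subsingleton [IsAlgClosed L] [CharZero L] (f g : A[X])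
    (hW : (wr f g).map (residue A) ≠ 0)
    (hcop : ∀ t, f.eval t = 0 → g.eval t ≠ 0)
    (himg : ∀ t t', residue A t = 0 → residue A t' = 0 → (wr f g).eval t = 0 →
      (wr f g).eval t' = 0 → f.eval t * g.eval t' = f.eval t' * g.eval t) :
    (∀ t t', residue A t = 0 → residue A t' = 0 → (wr f g).eval t = 0 →
      (wr f g).eval t' = 0 → t = t') ∧
    ¬((f.map (residue A)).eval 0 = 0 ∧ (g.map (residue A)).eval 0 = 0) := by
  have key : ∀ t₀, residue A t₀ = 0 → (wr f g).eval t₀ = 0 →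
      (∀ t, residue A t = 0 → (wr f g).eval t = 0 → t = t₀) ∧
      ¬((f.map (residue A)).eval 0 = 0 ∧ (g.map (residue A)).eval 0 = 0) := by
    intro t₀ ht₀ hWt₀
    -- The branch value or its inverse is integral; the second case exchanges the two target
    -- coordinates, which only changes the sign of the Wronskian.
    rcases ValuationRing.dvd_total (g.eval t₀) (f.eval t₀) with h | h
    · obtain ⟨h1, h2⟩ := ramified_subsingleton_aux f g hW hcop himg t₀ ht₀ hWt₀ h
      refine ⟨h1, fun h3 => h2 ?_⟩
      rw [← eval_map_apply, ht₀, h3.2]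
    · have hs : ∀ t, (wr g f).eval t = 0 ↔ (wr f g).eval t = 0 := fun t => by
        rw [wr_swap, eval_neg, neg_eq_zero]
      obtain ⟨h1, h2⟩ := ramified_subsingleton_aux g f
        (by rw [wr_swap, Polynomial.map_neg]; exact neg_ne_zero.mpr hW)
        (fun t hg hf => hcop t hf hg)
        (fun t t' ht ht' hWt hWt' => by
          linear_combination -himg t t' ht ht' ((hs t).mp hWt) ((hs t').mp hWt'))
        t₀ ht₀ ((hs t₀).mpr hWt₀) h
      refine ⟨fun t ht hWt => h1 t ht ((hs t).mpr hWt), fun h3 => h2 ?_⟩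
      rw [← eval_map_apply, ht₀, h3.1]
  refine ⟨fun t t' ht ht' hWt hWt' => (key t' ht' hWt').1 t ht hWt, fun h => ?_⟩
  -- A common zero of the reductions is a zero of the reduced Wronskian, so the disc contains a
  -- ramification point and `key` applies.
  obtain ⟨t, ht, hWt⟩ := exists_root_residue_eq_zero (wr f g) hW (by
    rw [wr_map, wr, eval_sub, eval_mul, eval_mul, h.1, h.2]; simp)
  exact (key t ht hWt).2 h

end LocalTheory

/-! ### Binary forms restricted to lines, and ramification in a chart. -/

section Charts

/-- The restriction of a form to the line `t ↦ p + t q`. -/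
def chart {R : Type*} [CommRing R] (p q : Fin 2 → R) : MvPolynomial (Fin 2) R →ₐ[R] R[X] :=
  MvPolynomial.aeval fun i => C (p i) + C (q i) * X

/-- The linear form that defines the point with coordinates `p`. -/
def linForm {R : Type*} [CommRing R] (p : Fin 2 → R) : MvPolynomial (Fin 2) R :=
  MvPolynomial.C (p 1) * MvPolynomial.X 0 - MvPolynomial.C (p 0) * MvPolynomial.X 1

theorem chart_map {R S : Type*} [CommRing R] [CommRing S] (φ : R →+* S) (p q : Fin 2 → R)
    (F : MvPolynomial (Fin 2) R) :
    (chart p q F).map φ = chart (φ ∘ p) (φ ∘ q) (F.map φ) := by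
  induction F using MvPolynomial.induction_on with
  | C a => simp [chart]
  | add F G hF hG => simp [hF, hG]
  | mul_X F i hF =>
    rw [map_mul, Polynomial.map_mul, hF, map_mul, map_mul]
    simp [chart]

theorem eval_chart {R : Type*} [CommRing R] (p q : Fin 2 → R) (F : MvPolynomial (Fin 2) R) (t : R) :
    (chart p q F).eval t = MvPolynomial.eval (p + t • q) F := by
  induction F using MvPolynomial.induction_on with
  | C a => simp [chart]
  | add F G hF hG => simp [hF, hG]
  | mul_X F i hF =>
    rw [map_mul, eval_mul, hF, map_mul]
    simp [chart, mul_comm t]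

/-- Moving the base point along the line is a Taylor shift, so orders of vanishing at any t can be
read off at 0. -/
theorem chart_add_smul {R : Type*} [CommRing R] (p q : Fin 2 → R) (F : MvPolynomial (Fin 2) R)
    (t : R) : chart (p + t • q) q F = taylor t (chart p q F) := by
  induction F using MvPolynomial.induction_on with
  | C a => simp [chart]
  | add F G hF hG => simp [hF, hG]
  | mul_X F i hF =>
    rw [map_mul, hF, map_mul, taylor_mul]
    congr 1
    simp [chart, taylor_mul]
    ring

theorem eval_smul_of_isHomogeneous {R σ : Type*} [CommRing R] {d : ℕ} {F : MvPolynomial σ R}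
    (hF : F.IsHomogeneous d) (c : R) (v : σ → R) :
    MvPolynomial.eval (c • v) F = c ^ d * MvPolynomial.eval v F := by
  rw [MvPolynomial.eval_eq, MvPolynomial.eval_eq, Finset.mul_sum]
  refine Finset.sum_congr rfl fun m hm => ?_
  have hdeg : m.degree = d := by
    have := hF (MvPolynomial.mem_support_iff.mp hm)
    rw [Finsupp.degree_eq_weight_one (R := ℕ)]
    exact this
  have : ∏ i ∈ m.support, (c • v) i ^ m i = c ^ d * ∏ i ∈ m.support, v i ^ m i := by
    rw [← hdeg, Finsupp.degree_apply, ← Finset.prod_pow_eq_pow_sum, ← Finset.prod_mul_distrib]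
    exact Finset.prod_congr rfl fun i _ => by simp [mul_pow]
  rw [this]
  ring

theorem chart_linForm {R : Type*} [CommRing R] (p q : Fin 2 → R) :
    chart p q (linForm p) = C (p 1 * q 0 - p 0 * q 1) * X := by
  simp only [chart, linForm, map_sub, map_mul, MvPolynomial.aeval_C, MvPolynomial.aeval_X,
    ← Polynomial.C_eq_algebraMap]
  ring

variable {k : Type*} [Field k]

/-- The order of vanishing of a form at a point can be computed in a chart. -/
theorem linForm_sq_dvd_iff {d : ℕ} {F : MvPolynomial (Fin 2) k} (hF : F.IsHomogeneous d)
    (p q : Fin 2 → k) (hpq : p 1 * q 0 - p 0 * q 1 ≠ 0) :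
    linForm p ^ 2 ∣ F ↔ X ^ 2 ∣ chart p q F := by
  constructor
  · intro h
    have := map_dvd (chart p q) h
    rw [map_pow, chart_linForm, mul_pow] at this
    exact (Dvd.intro_left _ rfl).trans this
  · rintro ⟨u, hu⟩
    set D := p 1 * q 0 - p 0 * q 1 with hD
    -- σ is the linear change of coordinates to the basis q, p, and τ is its inverse. Setting the
    -- second variable to 1 in σF gives the chart, so F is τ of the homogenized chart, and τ sends
    -- the first variable to a multiple of `linForm p`.
    let σ : MvPolynomial (Fin 2) k →ₐ[k] MvPolynomial (Fin 2) k := MvPolynomial.aeval fun i =>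
      MvPolynomial.C (p i) * MvPolynomial.X 1 + MvPolynomial.C (q i) * MvPolynomial.X 0
    let τ : MvPolynomial (Fin 2) k →ₐ[k] MvPolynomial (Fin 2) k := MvPolynomial.aeval
      ![MvPolynomial.C D⁻¹ * linForm p,
        MvPolynomial.C D⁻¹ * (MvPolynomial.C (q 0) * MvPolynomial.X 1 -
          MvPolynomial.C (q 1) * MvPolynomial.X 0)]
    have hDD : (MvPolynomial.C D : MvPolynomial (Fin 2) k) * MvPolynomial.C D⁻¹ = 1 := by
      rw [← MvPolynomial.C_mul, mul_inv_cancel₀ hpq, MvPolynomial.C_1]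
    have hτσ : τ (σ F) = F := by
      have : τ.comp σ = AlgHom.id k _ := by
        apply MvPolynomial.algHom_ext
        intro i
        have hD' : (MvPolynomial.C D : MvPolynomial (Fin 2) k) =
            MvPolynomial.C (p 1) * MvPolynomial.C (q 0) -
              MvPolynomial.C (p 0) * MvPolynomial.C (q 1) := by
          simp [hD]
        rw [hD'] at hDD
        fin_cases i
        · simp [σ, τ, linForm, MvPolynomial.algebraMap_eq]
          linear_combination (MvPolynomial.X 0) * hDD
        · simp [σ, τ, linForm, MvPolynomial.algebraMap_eq]
          linear_combination (MvPolynomial.X 1) * hDD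
      exact DFunLike.congr_fun this F
    have hσ : (σ F).IsHomogeneous d := by
      have := hF.aeval (S := k) (τ := Fin 2) (n := 1) (fun i => MvPolynomial.C (p i) * MvPolynomial.X 1 +
        MvPolynomial.C (q i) * MvPolynomial.X 0) fun i =>
          (MvPolynomial.isHomogeneous_C_mul_X _ _).add (MvPolynomial.isHomogeneous_C_mul_X _ _)
      rw [one_mul] at this
      exact this
    have hσF : MvPolynomial.aeval ![X, 1] (σ F) = chart p q F := by
      have : (MvPolynomial.aeval ![X, 1]).comp σ = chart p q := by
        apply MvPolynomial.algHom_ext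
        intro i
        simp [σ, chart, Polynomial.C_eq_algebraMap]
      exact DFunLike.congr_fun this F
    have hhom := Polynomial.homogenize_eq_of_isHomogeneous hσ hσF
    by_cases hu0 : u = 0
    · rw [hu, hu0, mul_zero, Polynomial.homogenize_zero] at hhom
      rw [← hτσ, ← hhom, map_zero]
      exact dvd_zero _
    have hdeg : (chart p q F).natDegree ≤ d := by
      refine natDegree_le_iff_coeff_eq_zero.mpr fun N hN => ?_
      have hFd := hF.totalDegree_le
      have := MvPolynomial.aeval_natDegree_le F hFd (fun i => C (p i) + C (q i) * X) (n := 1)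
        fun i => by
          refine (natDegree_add_le _ _).trans (max_le (by simp) ?_)
          exact (natDegree_C_mul_le _ _).trans natDegree_X_le
      exact coeff_eq_zero_of_natDegree_lt (lt_of_le_of_lt this (by omega))
    have hdu : 2 + u.natDegree ≤ d := by
      rw [hu, natDegree_mul (pow_ne_zero _ X_ne_zero) hu0, natDegree_X_pow] at hdeg
      exact hdeg
    -- The degree bound lets the homogenization of X²u split as the square of the first variable
    -- times a form of degree d - 2.
    obtain ⟨e, rfl⟩ := Nat.exists_eq_add_of_le (le_trans (Nat.le_add_right 2 _) hdu)
    rw [hu, Polynomial.homogenize_mul _ _ (natDegree_X_pow_le 2) (by omega),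
      Polynomial.homogenize_X_pow le_rfl] at hhom
    rw [← hτσ, ← hhom]
    simp only [map_mul, map_pow, Nat.sub_self, pow_zero, mul_one]
    refine Dvd.dvd.mul_right (pow_dvd_pow_of_dvd ?_ 2) _
    simp [τ]

/-- `[F : G]` is ramified at the point with coordinates `v`. -/
def IsRam (F G : MvPolynomial (Fin 2) k) (v : Fin 2 → k) : Prop :=
  linForm v ^ 2 ∣ MvPolynomial.C (MvPolynomial.eval v G) * F -
    MvPolynomial.C (MvPolynomial.eval v F) * G

theorem isRam_smul {d : ℕ} {F G : MvPolynomial (Fin 2) k} (hF : F.IsHomogeneous d)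
    (hG : G.IsHomogeneous d) {c : k} (hc : c ≠ 0) (v : Fin 2 → k) :
    IsRam F G (c • v) ↔ IsRam F G v := by
  have h1 : linForm (c • v) = MvPolynomial.C c * linForm v := by
    simp [linForm]
    ring
  have hu : ∀ n : ℕ, IsUnit (MvPolynomial.C c ^ n : MvPolynomial (Fin 2) k) := fun n =>
    ((isUnit_iff_ne_zero.mpr hc).map MvPolynomial.C).pow n
  have h2 : MvPolynomial.C (MvPolynomial.eval (c • v) G) * F -
      MvPolynomial.C (MvPolynomial.eval (c • v) F) * G = MvPolynomial.C c ^ d *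
        (MvPolynomial.C (MvPolynomial.eval v G) * F - MvPolynomial.C (MvPolynomial.eval v F) * G) := by
    rw [eval_smul_of_isHomogeneous hF, eval_smul_of_isHomogeneous hG]
    simp
    ring
  rw [IsRam, IsRam, h1, h2, mul_pow, (hu d).dvd_mul_left, (hu 2).mul_left_dvd]

theorem isRam_C_mul (F G : MvPolynomial (Fin 2) k) {c : k} (hc : c ≠ 0) (v : Fin 2 → k) :
    IsRam (MvPolynomial.C c * F) (MvPolynomial.C c * G) v ↔ IsRam F G v := by
  have hu : IsUnit (MvPolynomial.C c ^ 2 : MvPolynomial (Fin 2) k) :=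
    ((isUnit_iff_ne_zero.mpr hc).map MvPolynomial.C).pow 2
  have h : MvPolynomial.C (MvPolynomial.eval v (MvPolynomial.C c * G)) * (MvPolynomial.C c * F) -
      MvPolynomial.C (MvPolynomial.eval v (MvPolynomial.C c * F)) * (MvPolynomial.C c * G) =
        MvPolynomial.C c ^ 2 *
        (MvPolynomial.C (MvPolynomial.eval v G) * F - MvPolynomial.C (MvPolynomial.eval v F) * G) := by
    simp
    ring
  rw [IsRam, IsRam, h, hu.dvd_mul_left]

/-- In a chart, the ramification points are the zeros of the Wronskian. -/
theorem isRam_iff {d : ℕ} {F G : MvPolynomial (Fin 2) k} (hF : F.IsHomogeneous d)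
    (hG : G.IsHomogeneous d) (p q : Fin 2 → k) (hpq : p 1 * q 0 - p 0 * q 1 ≠ 0) (t : k) :
    IsRam F G (p + t • q) ↔ (wr (chart p q F) (chart p q G)).eval t = 0 := by
  have hH : (MvPolynomial.C (MvPolynomial.eval (p + t • q) G) * F -
      MvPolynomial.C (MvPolynomial.eval (p + t • q) F) * G).IsHomogeneous d :=
    (hF.C_mul _).sub (hG.C_mul _)
  have hdet : (p + t • q) 1 * q 0 - (p + t • q) 0 * q 1 ≠ 0 := by
    simp only [Pi.add_apply, Pi.smul_apply, smul_eq_mul]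
    convert hpq using 1
    ring
  have hC : ∀ (c : k) (v : Fin 2 → k), chart v q (MvPolynomial.C c) = C c := fun c v => by
    simp [chart]
  rw [IsRam, linForm_sq_dvd_iff hH _ q hdet, map_sub, map_mul, map_mul, hC, hC, chart_add_smul,
    chart_add_smul, ← eval_chart, ← eval_chart, X_pow_dvd_iff]
  -- With the chart centred at t, coefficient 0 of the fibre form vanishes identically and
  -- coefficient 1 is the Wronskian at t.
  constructor
  · intro h
    have := h 1 (by norm_num)
    simp only [coeff_sub, coeff_C_mul, taylor_coeff_one] at this
    simp only [wr, eval_sub, eval_mul]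
    linear_combination this
  · intro h i hi
    simp only [wr, eval_sub, eval_mul] at h
    interval_cases i
    · simp only [coeff_sub, coeff_C_mul, taylor_coeff_zero]
      ring
    · simp only [coeff_sub, coeff_C_mul, taylor_coeff_one]
      linear_combination h

/-- If the Wronskian is nonzero in the standard chart, then it is nonzero in every chart. -/
theorem wr_chart_ne_zero [Infinite k] {d : ℕ} {F G : MvPolynomial (Fin 2) k}
    (hF : F.IsHomogeneous d) (hG : G.IsHomogeneous d) (p q : Fin 2 → k)
    (hpq : p 1 * q 0 - p 0 * q 1 ≠ 0)
    (h : wr (chart ![0, 1] ![1, 0] F) (chart ![0, 1] ![1, 0] G) ≠ 0) :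
    wr (chart p q F) (chart p q G) ≠ 0 := by
  intro h0
  -- The chart at p in direction q misses only the point q; the linear factor discards it, and at
  -- every other x the vanishing transfers because ramification is intrinsic.
  have hz : (C (q 1) * X - C (q 0)) *
      wr (chart ![0, 1] ![1, 0] F) (chart ![0, 1] ![1, 0] G) = 0 := by
    apply Polynomial.funext
    intro x
    rw [eval_mul, eval_zero, mul_eq_zero]
    by_cases hx : q 1 * x - q 0 = 0
    · left
      simpa using hx
    right
    rw [← isRam_iff hF hG _ _ (by simp)]
    set D := p 1 * q 0 - p 0 * q 1 with hD
    set e := q 1 * x - q 0 with he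
    have hα : -e / D ≠ 0 := div_ne_zero (neg_ne_zero.mpr hx) hpq
    -- The two scalars come from solving (x, 1) = α(p + sq) by Cramer's rule.
    have hv : (![0, 1] + x • ![1, 0] : Fin 2 → k) = (-e / D) • (p + ((p 0 - p 1 * x) / e) • q) := by
      ext i
      fin_cases i
      · simp
        field_simp
        rw [hD, he]
        ring
      · simp
        field_simp
        rw [hD, he]
        ring
    rw [hv, isRam_smul hF hG hα, isRam_iff hF hG p q hpq, h0, eval_zero]
  rcases mul_eq_zero.mp hz with h1 | h1
  · have e1 : q 1 = 0 := by simpa using congrArg (fun r => coeff r 1) h1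
    have e0 : q 0 = 0 := by simpa using congrArg (fun r => coeff r 0) h1
    simp [e0, e1] at hpq
  · exact h h1

theorem chart_std_homogenize {f : k[X]} {d : ℕ} (hf : f.natDegree ≤ d) :
    chart ![0, 1] ![1, 0] (f.homogenize d) = f := by
  rw [chart, Polynomial.aeval_homogenize_of_eq_one hf _ (by simp)]
  simp

end Charts

/-! ### Separability and the Wronskian. -/

section Separable

open scoped IntermediateField.algebraAdjoinAdjoin

variable {k : Type*} [Field k]

/-- Up to a scalar, num - φ·denom is the minimal polynomial of x over k(φ). Its derivative at x,
multiplied by the denominator, is the Wronskian, so a zero Wronskian would make x inseparable. -/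
theorem wr_num_denom_ne_zero (φ : RatFunc k) [Algebra.IsSeparable k⟮φ⟯ (RatFunc k)] :
    wr φ.num φ.denom ≠ 0 := by
  intro hW
  -- For constant φ, separability would make k(x) algebraic over k.
  have hφ : ¬∃ c, φ = RatFunc.C c := by
    rintro ⟨c, rfl⟩
    have hint : IsIntegral k (RatFunc.C c : RatFunc k) := isIntegral_algebraMap
    have h1 := IntermediateField.isAlgebraic_adjoin_simple hint
    have h2 : Algebra.IsAlgebraic k (RatFunc k) :=
      Algebra.IsAlgebraic.trans k k⟮(RatFunc.C c : RatFunc k)⟯ (RatFunc k)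
    have tr : Algebra.Transcendental k (RatFunc k) := by infer_instance
    exact Algebra.transcendental_iff_not_isAlgebraic.mp tr h2
  have hirr := φ.irreducible_minpolyX hφ
  have hroot := φ.minpolyX_aeval_X
  have hsep : (φ.minpolyX k⟮φ⟯).Separable := by
    have hx := Algebra.IsSeparable.isSeparable k⟮φ⟯ (RatFunc.X : RatFunc k)
    have hassoc := minpoly.eq_of_irreducible hirr hroot
    rw [IsSeparable, ← hassoc] at hx
    exact hx.of_mul_left
  have hne := hsep.aeval_derivative_ne_zero hroot
  apply hne
  have hden : algebraMap k[X] (RatFunc k) φ.denom ≠ 0 := by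
    simpa using φ.denom_ne_zero
  have hW' := congrArg (algebraMap k[X] (RatFunc k)) hW
  simp only [wr, map_sub, map_mul, map_zero] at hW'
  have hnd : algebraMap k[X] (RatFunc k) φ.num = φ * algebraMap k[X] (RatFunc k) φ.denom := by
    rw [← div_eq_iff hden, RatFunc.num_div_denom]
  rw [hnd] at hW'
  apply mul_right_cancel₀ hden
  rw [zero_mul]
  simp only [derivative_mul, derivative_C, derivative_map, map_sub, map_mul, zero_mul, zero_add,
    aeval_map_algebraMap, aeval_C, RatFunc.aeval_X_left_eq_algebraMap]
  change (_ - φ * _) * _ = 0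
  linear_combination hW'

end Separable

/-- A monic lift has a root in L, which lies in `A` because valuation rings are integrally closed.
-/
instance isAlgClosed_residueField {L : Type*} [Field L] [IsAlgClosed L] (A : ValuationSubring L) :
    IsAlgClosed (ResidueField A) := by
  refine IsAlgClosed.of_exists_root _ fun P hP hirr => ?_
  have hlift : P ∈ lifts (residue A) := by
    rw [lifts_iff_coeff_lifts]
    exact fun n => residue_surjective _
  obtain ⟨Q, rfl, hdeg, hQ⟩ := lifts_and_natDegree_eq_and_monic hlift hP
  have hd : (Q.map (algebraMap A L)).degree ≠ 0 := by
    rw [hQ.degree_map, ← hQ.degree_map (residue A)]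
    exact hirr.degree_pos.ne'
  obtain ⟨x, hx⟩ := IsAlgClosed.exists_root _ hd
  have hxi : IsIntegral A x := ⟨Q, hQ, by rwa [IsRoot, eval_map] at hx⟩
  obtain ⟨y, rfl⟩ := IsIntegrallyClosed.isIntegral_iff.mp hxi
  refine ⟨residue A y, ?_⟩
  have : Q.eval y = 0 := by
    apply FaithfulSMul.algebraMap_injective A L
    rw [map_zero, ← hx]
    exact (eval_map_apply _ _).symm
  rw [eval_map_apply, this, map_zero]

/-! ### Residue discs of the projective line. -/

section Discs

variable {L : Type*} [Field L] {A : ValuationSubring L}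

theorem coe_ne_zero {a : Fin 2 → A} (ha : ∃ i, IsUnit (a i)) : (fun i => (a i : L)) ≠ 0 := by
  obtain ⟨i, hi⟩ := ha
  intro h
  have : (a i : L) = 0 := congrFun h i
  exact hi.ne_zero (Subtype.ext this)

/-- The point with given coordinates in `A`, one of them a unit. -/
def primPt (a : Fin 2 → A) (ha : ∃ i, IsUnit (a i)) : Pt L :=
  Projectivization.mk L (fun i => (a i : L)) (coe_ne_zero ha)

theorem exists_primPt_eq (P : Pt L) : ∃ (a : Fin 2 → A) (ha : ∃ i, IsUnit (a i)), primPt a ha = P := by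
  obtain ⟨a, ha, h, hP⟩ := exists_primitive_coords A P
  exact ⟨a, ha, hP⟩

theorem reducePt_primPt (a : Fin 2 → A) (ha : ∃ i, IsUnit (a i)) :
    reducePt A (primPt a ha) = Projectivization.mk _ _ (residue_ne_zero A ha) :=
  reducePt_mk A a ha _

theorem exists_isUnit_of_residue_ne_zero {a : Fin 2 → A} (h : (fun i => residue A (a i)) ≠ 0) :
    ∃ i, IsUnit (a i) := by
  obtain ⟨i, hi⟩ := Function.ne_iff.mp h
  exact ⟨i, (residue_ne_zero_iff_isUnit _).mp hi⟩

theorem exists_isUnit_det {p : Fin 2 → A} (hp : ∃ i, IsUnit (p i)) :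
    ∃ q : Fin 2 → A, IsUnit (p 1 * q 0 - p 0 * q 1) := by
  obtain ⟨i, hi⟩ := hp
  fin_cases i
  · exact ⟨![0, 1], by simpa using hi⟩
  · exact ⟨![1, 0], by simpa using hi⟩

theorem residue_add_smul {p q : Fin 2 → A} {t : A} (ht : residue A t = 0) :
    (fun i => residue A ((p + t • q) i)) = fun i => residue A (p i) := by
  ext i
  simp [ht]

theorem exists_isUnit_add_smul {p q : Fin 2 → A} (hp : ∃ i, IsUnit (p i)) {t : A}
    (ht : residue A t = 0) : ∃ i, IsUnit ((p + t • q) i) := by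
  apply exists_isUnit_of_residue_ne_zero
  rw [residue_add_smul ht]
  exact residue_ne_zero A hp

theorem reducePt_primPt_add_smul {p q : Fin 2 → A} (hp : ∃ i, IsUnit (p i)) {t : A}
    (ht : residue A t = 0) :
    reducePt A (primPt (p + t • q) (exists_isUnit_add_smul hp ht)) = reducePt A (primPt p hp) := by
  rw [reducePt_primPt, reducePt_primPt]
  congr 1
  exact residue_add_smul ht

/-- As p, q is a basis of A², write r = αp + βq. Equal reductions give β ≡ 0 and hence α a unit, and
t = β/α is the disc parameter. -/
theorem exists_primPt_add_smul_eq {p q : Fin 2 → A} (hp : ∃ i, IsUnit (p i))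
    (hpq : IsUnit (p 1 * q 0 - p 0 * q 1)) {P : Pt L}
    (hP : reducePt A P = reducePt A (primPt p hp)) :
    ∃ (t : A) (ht : residue A t = 0),
      primPt (p + t • q) (exists_isUnit_add_smul hp ht) = P := by
  obtain ⟨r, hr, rfl⟩ := exists_primPt_eq (A := A) P
  rw [reducePt_primPt, reducePt_primPt, Projectivization.mk_eq_mk_iff'] at hP
  obtain ⟨c, hc⟩ := hP
  have h0 : c * residue A (p 0) = residue A (r 0) := congrFun hc 0
  have h1 : c * residue A (p 1) = residue A (r 1) := congrFun hc 1
  obtain ⟨D, hD⟩ := hpq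
  have hDi : (p 1 * q 0 - p 0 * q 1) * (↑D⁻¹ : A) = 1 := by rw [← hD, D.mul_inv]
  set E : A := (↑D⁻¹ : A)
  set α : A := (r 1 * q 0 - r 0 * q 1) * E with hα
  set β : A := (p 1 * r 0 - p 0 * r 1) * E with hβ
  have hr0 : r 0 = α * p 0 + β * q 0 := by
    rw [hα, hβ]; linear_combination (-r 0) * hDi
  have hr1 : r 1 = α * p 1 + β * q 1 := by
    rw [hα, hβ]; linear_combination (-r 1) * hDi
  have hβ0 : residue A β = 0 := by
    rw [hβ, map_mul, map_sub, map_mul, map_mul, ← h0, ← h1]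
    ring
  have hαu : IsUnit α := by
    rw [← residue_ne_zero_iff_isUnit]
    intro hα0
    obtain ⟨i, hi⟩ := Function.ne_iff.mp (residue_ne_zero A hr)
    apply hi
    fin_cases i
    · simp [hr0, hα0, hβ0]
    · simp [hr1, hα0, hβ0]
  obtain ⟨u, hu⟩ := hαu
  refine ⟨β * (↑u⁻¹ : A), by rw [map_mul, hβ0, zero_mul], ?_⟩
  have huu : α * (↑u⁻¹ : A) = 1 := by rw [← hu, u.mul_inv]
  rw [primPt, primPt, Projectivization.mk_eq_mk_iff']
  refine ⟨((↑u⁻¹ : A) : L), ?_⟩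
  ext i
  simp only [Pi.smul_apply, smul_eq_mul]
  rw [← MulMemClass.coe_mul]
  congr 1
  fin_cases i
  · simp [hr0]
    linear_combination (p 0) * huu
  · simp [hr1]
    linear_combination (p 1) * huu

end Discs

/-! ### From residue discs to the whole line. -/

section Global

variable {L : Type*} [Field L] {A : ValuationSubring L}

/-- `[F : G]` is a morphism of the line over `L` whose coefficients are in `A` and whose reduction
is separable; `φ` is the induced map on points and `R` its set of ramification points. -/
structure IsModel (d : ℕ) (F G : MvPolynomial (Fin 2) A) (φ : Pt L → Pt L) (R : Set (Pt L)) :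
    Prop where
  homF : F.IsHomogeneous d
  homG : G.IsHomogeneous d
  noZero : ∀ v : Fin 2 → L, v ≠ 0 → (![MvPolynomial.eval v (F.map (algebraMap A L)),
    MvPolynomial.eval v (G.map (algebraMap A L))] : Fin 2 → L) ≠ 0
  wr_ne_zero : wr (chart ![0, 1] ![1, 0] (F.map (residue A)))
    (chart ![0, 1] ![1, 0] (G.map (residue A))) ≠ 0
  mem_iff : ∀ (v : Fin 2 → L) (hv : v ≠ 0), Projectivization.mk L v hv ∈ R ↔
    IsRam (F.map (algebraMap A L)) (G.map (algebraMap A L)) v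
  map_eq : ∀ (v : Fin 2 → L) (hv : v ≠ 0),
    φ (Projectivization.mk L v hv) = Projectivization.mk L _ (noZero v hv)

/-- The two forms have no common zero. -/
def NoCommonZero {k : Type*} [Field k] (F G : MvPolynomial (Fin 2) k) : Prop :=
  ∀ v : Fin 2 → k, v ≠ 0 → ¬(MvPolynomial.eval v F = 0 ∧ MvPolynomial.eval v G = 0)

variable {d : ℕ} {F G : MvPolynomial (Fin 2) A} {φ : Pt L → Pt L} {R : Set (Pt L)}

theorem eval_map_coe {S : Type*} [CommRing S] (ψ : A →+* S) (F : MvPolynomial (Fin 2) A)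
    (a : Fin 2 → A) :
    MvPolynomial.eval (fun i => ψ (a i)) (F.map ψ) = ψ (MvPolynomial.eval a F) := by
  rw [MvPolynomial.eval_map, MvPolynomial.eval₂_comp]
  rfl

theorem IsModel.finite (h : IsModel d F G φ R) : R.Finite := by
  set W := wr (chart ![0, 1] ![1, 0] F) (chart ![0, 1] ![1, 0] G) with hW
  -- The Wronskian is compatible with both reduction and passage to L, so its nonvanishing over the
  -- residue field gives nonvanishing over L.
  have hvec : ∀ {S : Type _} [CommRing S] (ψ : A →+* S),
      W.map ψ = wr (chart ![0, 1] ![1, 0] (F.map ψ)) (chart ![0, 1] ![1, 0] (G.map ψ)) := by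
    intro S _ ψ
    have e1 : ψ ∘ ![(0 : A), 1] = ![0, 1] := by ext i; fin_cases i <;> simp
    have e2 : ψ ∘ ![(1 : A), 0] = ![1, 0] := by ext i; fin_cases i <;> simp
    rw [hW, wr_map, chart_map, chart_map, e1, e2]
  have hW0 : W ≠ 0 := by
    intro h0
    apply h.wr_ne_zero
    rw [← hvec, h0, Polynomial.map_zero]
  have hWL : W.map (algebraMap A L) ≠ 0 :=
    (Polynomial.map_ne_zero_iff (FaithfulSMul.algebraMap_injective A L)).mpr hW0
  have hne : ∀ t : L, (![t, 1] : Fin 2 → L) ≠ 0 := fun t h => by simpa using congrFun h 1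
  have hne' : (![1, 0] : Fin 2 → L) ≠ 0 := fun h => by simpa using congrFun h 0
  refine Set.Finite.subset (((Polynomial.finite_setOfPred_isRoot hWL).image
    fun t => Projectivization.mk L _ (hne t)).union
      (Set.finite_singleton (Projectivization.mk L _ hne'))) ?_
  intro P hP
  induction P using Projectivization.ind with
  | h v hv =>
  by_cases hv1 : v 1 = 0
  · right
    rw [Set.mem_singleton_iff, Projectivization.mk_eq_mk_iff']
    refine ⟨v 0, ?_⟩
    ext i
    fin_cases i <;> simp [hv1]
  · left
    have hPeq : Projectivization.mk L v hv = Projectivization.mk L _ (hne (v 0 / v 1)) := by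
      rw [Projectivization.mk_eq_mk_iff']
      refine ⟨v 1, ?_⟩
      ext i
      fin_cases i <;> simp [hv1, mul_div_cancel₀]
    refine ⟨v 0 / v 1, ?_, hPeq.symm⟩
    rw [hPeq, h.mem_iff] at hP
    have e : (![v 0 / v 1, 1] : Fin 2 → L) = ![0, 1] + (v 0 / v 1) • ![1, 0] := by
      ext i
      fin_cases i <;> simp
    rw [e, isRam_iff (h.homF.map _) (h.homG.map _) _ _ (by simp)] at hP
    rw [Set.mem_ofPred_eq, IsRoot, hvec]
    exact hP

theorem IsModel.primPt_mem_iff (h : IsModel d F G φ R) {p q : Fin 2 → A}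
    (hp : ∃ i, IsUnit (p i)) (hpq : IsUnit (p 1 * q 0 - p 0 * q 1)) {t : A}
    (ht : residue A t = 0) :
    primPt (p + t • q) (exists_isUnit_add_smul hp ht) ∈ R ↔
      (wr (chart p q F) (chart p q G)).eval t = 0 := by
  have hinj := FaithfulSMul.algebraMap_injective A L
  have e : (fun i => ((p + t • q) i : L)) =
      (algebraMap A L ∘ p) + (algebraMap A L t) • (algebraMap A L ∘ q) := rfl
  have hdet : (algebraMap A L ∘ p) 1 * (algebraMap A L ∘ q) 0 -
      (algebraMap A L ∘ p) 0 * (algebraMap A L ∘ q) 1 ≠ 0 := by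
    simp only [Function.comp_apply, ← map_mul, ← map_sub]
    exact (map_ne_zero_iff _ hinj).mpr hpq.ne_zero
  rw [primPt, h.mem_iff, e, isRam_iff (h.homF.map _) (h.homG.map _) _ _ hdet, ← chart_map,
    ← chart_map, ← wr_map, eval_map_apply, map_eq_zero_iff _ hinj]

variable [IsAlgClosed L] [CharZero L]

/-- The local statement in the residue disc of the point with coordinates `p`. -/
theorem IsModel.disc (h : IsModel d F G φ R) {p q : Fin 2 → A}
    (hp : ∃ i, IsUnit (p i)) (hpq : IsUnit (p 1 * q 0 - p 0 * q 1))
    (himg : ∀ (t t' : A) (ht : residue A t = 0) (ht' : residue A t' = 0),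
      primPt (p + t • q) (exists_isUnit_add_smul hp ht) ∈ R →
      primPt (p + t' • q) (exists_isUnit_add_smul hp ht') ∈ R →
      φ (primPt (p + t • q) (exists_isUnit_add_smul hp ht)) =
        φ (primPt (p + t' • q) (exists_isUnit_add_smul hp ht'))) :
    (∀ (t t' : A) (ht : residue A t = 0) (ht' : residue A t' = 0),
      primPt (p + t • q) (exists_isUnit_add_smul hp ht) ∈ R →
      primPt (p + t' • q) (exists_isUnit_add_smul hp ht') ∈ R → t = t') ∧
    ¬(MvPolynomial.eval (fun i => residue A (p i)) (F.map (residue A)) = 0 ∧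
      MvPolynomial.eval (fun i => residue A (p i)) (G.map (residue A)) = 0) := by
  have hinj := FaithfulSMul.algebraMap_injective A L
  have : Infinite (ResidueField A) := IsAlgClosed.instInfinite
  have hdet : (residue A ∘ p) 1 * (residue A ∘ q) 0 -
      (residue A ∘ p) 0 * (residue A ∘ q) 1 ≠ 0 := by
    simp only [Function.comp_apply, ← map_mul, ← map_sub]
    exact (residue_ne_zero_iff_isUnit _).mpr hpq
  have hD := (map_ne_zero_iff _ hinj).mpr hpq.ne_zero
  have hev : ∀ (H : MvPolynomial (Fin 2) A) (t : A), algebraMap A L ((chart p q H).eval t) =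
      MvPolynomial.eval (fun i => ((p + t • q) i : L)) (H.map (algebraMap A L)) := by
    intro H t
    rw [eval_chart]
    exact (eval_map_coe (algebraMap A L) H _).symm
  obtain ⟨h1, h2⟩ := ramified_subsingleton (chart p q F) (chart p q G)
    (by
      rw [wr_map, chart_map, chart_map]
      exact wr_chart_ne_zero (h.homF.map _) (h.homG.map _) _ _ hdet h.wr_ne_zero)
    (by
      intro t hf hg
      have hv : (fun i => ((p + t • q) i : L)) ≠ 0 := by
        intro hv
        have e0 : (p 0 : L) + t * q 0 = 0 := congrFun hv 0
        have e1 : (p 1 : L) + t * q 1 = 0 := congrFun hv 1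
        apply hD
        rw [map_sub, map_mul, map_mul]
        change (p 1 : L) * q 0 - p 0 * q 1 = 0
        linear_combination (q 0 : L) * e1 - q 1 * e0
      refine h.noZero _ hv ?_
      rw [← hev, ← hev, hf, hg, map_zero]
      ext i
      fin_cases i <;> rfl)
    (by
      intro t t' ht ht' hWt hWt'
      have := himg t t' ht ht' ((h.primPt_mem_iff hp hpq ht).mpr hWt)
        ((h.primPt_mem_iff hp hpq ht').mpr hWt')
      rw [primPt, primPt, h.map_eq, h.map_eq, Projectivization.mk_eq_mk_iff'] at this
      obtain ⟨c, hc⟩ := this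
      have c0 := congrFun hc 0
      have c1 := congrFun hc 1
      simp only [Pi.smul_apply, smul_eq_mul, Matrix.cons_val_zero, Matrix.cons_val_one,
        ← hev] at c0 c1
      apply hinj
      rw [map_mul, map_mul, ← c0, ← c1]
      ring)
  refine ⟨fun t t' ht ht' hR hR' => h1 t t' ht ht' ((h.primPt_mem_iff hp hpq ht).mp hR)
    ((h.primPt_mem_iff hp hpq ht').mp hR'), fun h3 => h2 ?_⟩
  rw [chart_map, chart_map, eval_chart, eval_chart, zero_smul, add_zero]
  exact h3

theorem IsModel.noCommonZero_of_injOn (h : IsModel d F G φ R) (hinj : Set.InjOn (reducePt A) R) :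
    NoCommonZero (F.map (residue A)) (G.map (residue A)) := by
  intro v hv h0
  choose p hpv using fun i => residue_surjective (R := A) (v i)
  obtain rfl : (fun i => residue A (p i)) = v := funext hpv
  have hp := exists_isUnit_of_residue_ne_zero hv
  obtain ⟨q, hpq⟩ := exists_isUnit_det hp
  -- Here the condition on images is trivial: two ramification points in one disc are equal.
  refine (h.disc hp hpq fun t t' ht ht' hR hR' => ?_).2 h0
  congr 1
  apply hinj hR hR'
  rw [reducePt_primPt_add_smul hp ht, reducePt_primPt_add_smul hp ht']

theorem IsModel.injOn_of_noCommonZero (h : IsModel d F G φ R)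
    (hgood : NoCommonZero (F.map (residue A)) (G.map (residue A)))
    (hinj : Set.InjOn (reducePt A) (φ '' R)) : Set.InjOn (reducePt A) R := by
  -- Without common zeros modulo the maximal ideal, the forms send primitive coordinates to
  -- primitive ones; so the reduction of φ(P) depends only on that of P.
  have hprim : ∀ (a : Fin 2 → A) (_ : ∃ i, IsUnit (a i)),
      ∃ i, IsUnit ((![MvPolynomial.eval a F, MvPolynomial.eval a G] : Fin 2 → A) i) := by
    intro a ha
    apply exists_isUnit_of_residue_ne_zero
    intro h0
    refine hgood _ (residue_ne_zero A ha) ⟨?_, ?_⟩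
    · rw [eval_map_coe]
      exact congrFun h0 0
    · rw [eval_map_coe]
      exact congrFun h0 1
  have hφ : ∀ (a : Fin 2 → A) (ha : ∃ i, IsUnit (a i)),
      φ (primPt a ha) = primPt _ (hprim a ha) := by
    intro a ha
    rw [primPt, primPt, h.map_eq]
    congr 1
    ext i
    fin_cases i
    · exact eval_map_coe (algebraMap A L) F a
    · exact eval_map_coe (algebraMap A L) G a
  have hred : ∀ (a b : Fin 2 → A) (ha : ∃ i, IsUnit (a i)) (hb : ∃ i, IsUnit (b i)),
      (fun i => residue A (a i)) = (fun i => residue A (b i)) →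
      reducePt A (φ (primPt a ha)) = reducePt A (φ (primPt b hb)) := by
    intro a b ha hb hab
    rw [hφ, hφ, reducePt_primPt, reducePt_primPt]
    congr 1
    ext i
    fin_cases i
    · change residue A (MvPolynomial.eval a F) = residue A (MvPolynomial.eval b F)
      rw [← eval_map_coe, ← eval_map_coe, hab]
    · change residue A (MvPolynomial.eval a G) = residue A (MvPolynomial.eval b G)
      rw [← eval_map_coe, ← eval_map_coe, hab]
  intro P hP Q hQ hPQ
  obtain ⟨p, hp, rfl⟩ := exists_primPt_eq (A := A) Q
  obtain ⟨q, hpq⟩ := exists_isUnit_det hp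
  have h1 := (h.disc hp hpq fun t t' ht ht' hR hR' => by
    refine hinj ⟨_, hR, rfl⟩ ⟨_, hR', rfl⟩ (hred _ _ _ _ ?_)
    rw [residue_add_smul ht, residue_add_smul ht']).1
  obtain ⟨t, ht, rfl⟩ := exists_primPt_add_smul_eq hp hpq hPQ
  obtain ⟨t', ht', hQ'⟩ := exists_primPt_add_smul_eq hp hpq (rfl : reducePt A (primPt p hp) = _)
  rw [← hQ'] at hQ ⊢
  obtain rfl := h1 t t' ht ht' hP hQ
  rfl

/-- For a morphism with separable reduction, ramification and branch points are preserved by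
reduction if and only if the reduction has no common zero and the branch points are preserved. -/
theorem IsModel.nonsingularMod_iff (h : IsModel d F G φ R) :
    NonsingularMod A R ∧ NonsingularMod A (φ '' R) ↔
      NoCommonZero (F.map (residue A)) (G.map (residue A)) ∧ NonsingularMod A (φ '' R) := by
  -- Finiteness is essential: for infinite sets equal cardinality would not give injectivity.
  have key : ∀ E : Set (Pt L), E.Finite → (NonsingularMod A E ↔ Set.InjOn (reducePt A) E) :=
    fun E hE => ⟨fun h => hE.injOn_of_encard_image_eq h.symm, fun h => h.encard_image.symm⟩
  rw [key R h.finite, key _ (h.finite.image φ)]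
  exact ⟨fun ⟨h1, h2⟩ => ⟨h.noCommonZero_of_injOn h1, h2⟩,
    fun ⟨h1, h2⟩ => ⟨h.injOn_of_noCommonZero h1 h2, h2⟩⟩

end Global

theorem wr_mul_left {R : Type*} [CommRing R] (h f g : R[X]) :
    wr (h * f) (h * g) = h ^ 2 * wr f g := by
  simp only [wr, derivative_mul]
  ring

/-! ### Cancelled factors, common zeros and the degree. -/

section OfPair

variable {k : Type*} [Field k]

/-- The common factor that cancels in a separable morphism `f / g`. -/
theorem exists_eq_mul_num_den {f g : k[X]} (hsep : Mor.IsSeparable (Mor.ofPair f g)) :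
    ∃ h : k[X], h ≠ 0 ∧ f = h * Mor.num (Mor.ofPair f g) ∧ g = h * Mor.den (Mor.ofPair f g) ∧
      wr (Mor.num (Mor.ofPair f g)) (Mor.den (Mor.ofPair f g)) ≠ 0 := by
  by_cases hg : g = 0
  · rw [Mor.ofPair, if_pos hg] at hsep
    exact hsep.elim
  rw [Mor.ofPair, if_neg hg] at hsep ⊢
  set φ : RatFunc k := algebraMap k[X] (RatFunc k) f / algebraMap k[X] (RatFunc k) g with hφ
  have : Algebra.IsSeparable k⟮φ⟯ (RatFunc k) := hsep
  change ∃ h : k[X], h ≠ 0 ∧ f = h * φ.num ∧ g = h * φ.denom ∧ wr φ.num φ.denom ≠ 0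
  have hmul : φ.num * g = f * φ.denom := (RatFunc.num_mul_eq_mul_denom_iff hg).mpr hφ
  have hdvd : φ.denom ∣ g := (φ.isCoprime_num_denom.symm).dvd_of_dvd_mul_left
    (hmul ▸ Dvd.intro_left _ rfl)
  obtain ⟨h, hh⟩ := hdvd
  refine ⟨h, ?_, ?_, by rw [hh, mul_comm], wr_num_denom_ne_zero φ⟩
  · rintro rfl
    exact hg (by rw [hh, mul_zero])
  · apply mul_right_cancel₀ φ.denom_ne_zero
    rw [← hmul, hh]
    ring

theorem wr_ne_zero_of_isSeparable {f g : k[X]} (hsep : Mor.IsSeparable (Mor.ofPair f g)) :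
    wr f g ≠ 0 := by
  obtain ⟨h, hh, hf, hg, hW⟩ := exists_eq_mul_num_den hsep
  have h1 := wr_mul_left h (Mor.num (Mor.ofPair f g)) (Mor.den (Mor.ofPair f g))
  rw [← hf, ← hg] at h1
  rw [h1]
  exact mul_ne_zero (pow_ne_zero _ hh) hW

theorem eval_map_homogenize {κ : Type*} [Field κ] (ρ : k →+* κ) {f : k[X]} {d : ℕ}
    (hf : f.natDegree ≤ d) (x : κ) :
    MvPolynomial.eval ![x, 1] ((f.homogenize d).map ρ) = (f.map ρ).eval x := by
  rw [← Polynomial.homogenize_map, Polynomial.eval_homogenize (natDegree_map_le.trans hf) _ (by simp)]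
  simp

theorem eval_map_homogenize_infty {κ : Type*} [Field κ] (ρ : k →+* κ) {f : k[X]} {d : ℕ}
    (hf : f.coeff d = 0) : MvPolynomial.eval ![1, 0] ((f.homogenize d).map ρ) = 0 := by
  rw [MvPolynomial.eval_map, MvPolynomial.eval₂_eq]
  refine Finset.sum_eq_zero fun m hm => ?_
  rw [Polynomial.coeff_homogenize]
  split_ifs with h
  · by_cases h1 : m 1 = 0
    · rw [h1, add_zero] at h
      rw [h, hf, map_zero, zero_mul]
    · rw [Finset.prod_eq_zero (Finsupp.mem_support_iff.mpr h1) (by simp [h1]), mul_zero]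
  · simp

/-- The degree drops exactly when the forms have a common zero. -/
theorem deg_ofPair_eq_iff {κ : Type*} [Field κ] [IsAlgClosed κ] (ρ : k →+* κ) {f g : k[X]} {d : ℕ}
    (hf : f.natDegree ≤ d) (hg : g.natDegree ≤ d) (hsep : Mor.IsSeparable (Mor.ofPair f g)) :
    Mor.deg (Mor.ofPair f g) = d ↔
      NoCommonZero ((f.homogenize d).map ρ) ((g.homogenize d).map ρ) := by
  obtain ⟨h, hh, hfn, hgn, hW⟩ := exists_eq_mul_num_den hsep
  set Ψ := Mor.ofPair f g
  have hn0 : Mor.num Ψ ≠ 0 := by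
    intro h0
    simp [h0, wr] at hW
  have hd0 : Mor.den Ψ ≠ 0 := by
    intro h0
    simp [h0, wr] at hW
  have hdf : f.natDegree = h.natDegree + (Mor.num Ψ).natDegree := by
    conv_lhs => rw [hfn, natDegree_mul hh hn0]
  have hdg : g.natDegree = h.natDegree + (Mor.den Ψ).natDegree := by
    conv_lhs => rw [hgn, natDegree_mul hh hd0]
  constructor
  · intro hdeg v hv ⟨hF, hG⟩
    have hh0 : h.natDegree = 0 := by
      rw [Mor.deg] at hdeg
      omega
    obtain ⟨c, rfl⟩ := natDegree_eq_zero.mp hh0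
    have hc : ρ c ≠ 0 := by
      rw [_root_.map_ne_zero]
      rintro rfl
      exact hh C_0
    let _ : Algebra k κ := ρ.toAlgebra
    have hform : ∀ (q : k[X]), MvPolynomial.eval v (((C c * q).homogenize d).map ρ) = 0 →
        MvPolynomial.aeval v (q.homogenize d) = 0 := by
      intro q hq
      rw [Polynomial.homogenize_C_mul, map_mul, map_mul, MvPolynomial.map_C, MvPolynomial.eval_C,
        MvPolynomial.eval_map] at hq
      exact (mul_eq_zero.mp hq).resolve_left hc
    refine Mor.forms_ne_zero Ψ v hv ?_
    rw [Mor.formF, Mor.formG, hdeg, hform _ (hfn ▸ hF), hform _ (hgn ▸ hG)]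
    ext i
    fin_cases i <;> rfl
  · intro hno
    -- The degree can drop in two ways: both polynomials have degree below d, giving a common zero
    -- at [1:0], or they share a nonconstant factor h, giving one at a root of h. That root is
    -- sought in the algebraically closed field κ.
    have hmax : max f.natDegree g.natDegree = d := by
      by_contra hne
      refine hno ![1, 0] (fun h0 => by simpa using congrFun h0 0) ⟨?_, ?_⟩
      · exact eval_map_homogenize_infty ρ (coeff_eq_zero_of_natDegree_lt (by omega))
      · exact eval_map_homogenize_infty ρ (coeff_eq_zero_of_natDegree_lt (by omega))
    have hh0 : h.natDegree = 0 := by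
      by_contra hne
      have hdeg : (h.map ρ).degree ≠ 0 := by
        rw [degree_map]
        exact fun h0 => hne (natDegree_eq_of_degree_eq_some h0)
      obtain ⟨x, hx⟩ := IsAlgClosed.exists_root _ hdeg
      refine hno ![x, 1] (fun h0 => by simpa using congrFun h0 1) ⟨?_, ?_⟩
      · rw [eval_map_homogenize ρ hf, hfn, Polynomial.map_mul, eval_mul, hx, zero_mul]
      · rw [eval_map_homogenize ρ hg, hgn, Polynomial.map_mul, eval_mul, hx, zero_mul]
    rw [Mor.deg]
    omega

end OfPair

/-! ### Passing from the number field to its algebraic closure. -/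

section Model

variable {K L : Type*} [Field K] [Field L] [Algebra K L]

theorem one_lt_emultiplicity_iff {α : Type*} [Monoid α] (a b : α) :
    1 < emultiplicity a b ↔ a ^ 2 ∣ b := by
  rw [pow_dvd_iff_le_emultiplicity, ← ENat.add_one_le_iff ENat.one_ne_top, one_add_one_eq_two]
  rfl

theorem mem_ramificationSet_iff (Φ : Mor K) (v : Fin 2 → L) (hv : v ≠ 0) :
    Projectivization.mk L v hv ∈ Mor.ramificationSet L Φ ↔
      IsRam ((Mor.formF Φ).map (algebraMap K L)) ((Mor.formG Φ).map (algebraMap K L)) v := by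
  obtain ⟨c, hc⟩ := Projectivization.exists_smul_eq_mk_rep L v hv
  have hrep : (Projectivization.mk L v hv).rep = (c : L) • v := hc.symm
  have hF : ((Mor.formF Φ).map (algebraMap K L)).IsHomogeneous (Mor.deg Φ) :=
    (Polynomial.isHomogeneous_homogenize _).map _
  have hG : ((Mor.formG Φ).map (algebraMap K L)).IsHomogeneous (Mor.deg Φ) :=
    (Polynomial.isHomogeneous_homogenize _).map _
  rw [← isRam_smul hF hG c.ne_zero v, ← hrep]
  rw [Mor.ramificationSet, Set.mem_ofPred_eq, Mor.ramificationIdx, IsRam, one_lt_emultiplicity_iff,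
    MvPolynomial.eval_map, MvPolynomial.eval_map, ← MvPolynomial.aeval_def,
    ← MvPolynomial.aeval_def, linForm]

theorem map_mk (Φ : Mor K) (v : Fin 2 → L) (hv : v ≠ 0) :
    Mor.map Φ (Projectivization.mk L v hv) =
      Projectivization.mk L _ (Mor.forms_ne_zero Φ v hv) := by
  obtain ⟨c, hc⟩ := Projectivization.exists_smul_eq_mk_rep L v hv
  have hrep : (Projectivization.mk L v hv).rep = (c : L) • v := hc.symm
  rw [Mor.map, Projectivization.mk_eq_mk_iff']
  refine ⟨(c : L) ^ Mor.deg Φ, ?_⟩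
  have h : ∀ q : K[X], MvPolynomial.aeval (Projectivization.mk L v hv).rep
      (q.homogenize (Mor.deg Φ)) =
        (c : L) ^ Mor.deg Φ * MvPolynomial.aeval v (q.homogenize (Mor.deg Φ)) := by
    intro q
    rw [hrep, MvPolynomial.aeval_def, MvPolynomial.aeval_def, ← MvPolynomial.eval_map,
      ← MvPolynomial.eval_map]
    exact eval_smul_of_isHomogeneous ((Polynomial.isHomogeneous_homogenize _).map _) _ _
  ext i
  fin_cases i
  · exact (h (Mor.num Φ)).symm
  · exact (h (Mor.den Φ)).symm

variable (O : ValuationSubring K) (w : ValuationSubring L) (hw : w.comap (algebraMap K L) = O)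

/-- The inclusion of the valuation ring of `K` in the valuation ring of an extension. -/
def inclusion : O →+* w :=
  ((algebraMap K L).comp (algebraMap O K)).codRestrict w fun x => by
    have hx : (x : K) ∈ w.comap (algebraMap K L) := hw ▸ x.2
    exact hx

/-- Since O is the full preimage of w, an inverse that is integral upstairs is already integral over
K. This yields the map of residue fields. -/
theorem isLocalHom_inclusion : IsLocalHom (inclusion O w hw) := by
  refine ⟨fun x hx => ?_⟩
  obtain ⟨u, hu⟩ := hx
  have hmul : algebraMap K L x * ((↑u⁻¹ : w) : L) = 1 := by
    have : inclusion O w hw x * (↑u⁻¹ : w) = 1 := by rw [← hu, u.mul_inv]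
    exact congrArg Subtype.val this
  have hx0 : (x : K) ≠ 0 := by
    intro h0
    rw [h0, map_zero, zero_mul] at hmul
    exact zero_ne_one hmul
  have hinv : (x : K)⁻¹ ∈ O := by
    suffices algebraMap K L (x : K)⁻¹ ∈ w from hw ▸ this
    rw [map_inv₀, inv_eq_of_mul_eq_one_right hmul]
    exact Subtype.property _
  exact IsUnit.of_mul_eq_one ⟨(x : K)⁻¹, hinv⟩ (Subtype.ext (mul_inv_cancel₀ hx0))

theorem natDegree_le_of_isReducedForm {Φ : Mor K} {f g : O[X]} (h : IsReducedForm O Φ f g) :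
    f.natDegree ≤ Mor.deg Φ ∧ g.natDegree ≤ Mor.deg Φ := by
  obtain ⟨⟨c, hc, hf, hg⟩, -⟩ := h
  have hinj := FaithfulSMul.algebraMap_injective O K
  rw [← natDegree_map_eq_of_injective hinj f, ← natDegree_map_eq_of_injective hinj g, hf, hg,
    natDegree_C_mul hc, natDegree_C_mul hc]
  exact ⟨le_max_left _ _, le_max_right _ _⟩

theorem map_residue_inclusion [IsLocalHom (inclusion O w hw)] (f : O[X]) (d : ℕ) :
    ((f.homogenize d).map (inclusion O w hw)).map (residue w) =
      (((f.map (residue O)).homogenize d).map (ResidueField.map (inclusion O w hw))) := by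
  rw [Polynomial.homogenize_map, MvPolynomial.map_map, MvPolynomial.map_map]
  rfl

/-- A reduced form gives a model over the valuation ring of the algebraic closure. -/
theorem isModel_of_isReducedForm {Φ : Mor K} {f g : O[X]} (h : IsReducedForm O Φ f g)
    [IsLocalHom (inclusion O w hw)]
    (hsep : Mor.IsSeparable (Mor.ofPair (f.map (residue O)) (g.map (residue O)))) :
    IsModel (Mor.deg Φ) ((f.homogenize (Mor.deg Φ)).map (inclusion O w hw))
      ((g.homogenize (Mor.deg Φ)).map (inclusion O w hw)) (Mor.map Φ)
      (Mor.ramificationSet L Φ) := by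
  obtain ⟨hfd, hgd⟩ := natDegree_le_of_isReducedForm O h
  obtain ⟨⟨c, hc, hf, hg⟩, -⟩ := h
  -- Over L the model is the pair of forms of Φ scaled by the common constant c, which affects
  -- neither the map on points nor its ramification.
  have hform : ∀ (f : O[X]) (q : K[X]), f.map (algebraMap O K) = C c * q →
      ((f.homogenize (Mor.deg Φ)).map (inclusion O w hw)).map (algebraMap w L) =
        MvPolynomial.C (algebraMap K L c) *
          (q.homogenize (Mor.deg Φ)).map (algebraMap K L) := by
    intro f q hq
    rw [MvPolynomial.map_map]
    have : (algebraMap w L).comp (inclusion O w hw) = (algebraMap K L).comp (algebraMap O K) := rfl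
    rw [this, ← MvPolynomial.map_map, ← Polynomial.homogenize_map, hq,
      Polynomial.homogenize_C_mul, map_mul, MvPolynomial.map_C]
  have hcL : algebraMap K L c ≠ 0 := (_root_.map_ne_zero _).mpr hc
  have hev : ∀ (f : O[X]) (q : K[X]) (v : Fin 2 → L), f.map (algebraMap O K) = C c * q →
      MvPolynomial.eval v (((f.homogenize (Mor.deg Φ)).map (inclusion O w hw)).map
        (algebraMap w L)) =
          algebraMap K L c * MvPolynomial.aeval v (q.homogenize (Mor.deg Φ)) := by
    intro f q v hq
    rw [hform f q hq, map_mul, MvPolynomial.eval_C, MvPolynomial.eval_map]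
    rfl
  refine
    { homF := (Polynomial.isHomogeneous_homogenize _).map _
      homG := (Polynomial.isHomogeneous_homogenize _).map _
      noZero := fun v hv h0 => ?_
      wr_ne_zero := ?_
      mem_iff := fun v hv => ?_
      map_eq := fun v hv => ?_ }
  · apply Mor.forms_ne_zero Φ v hv
    have h1 := congrFun h0 0
    have h2 := congrFun h0 1
    simp only [Matrix.cons_val_zero, Matrix.cons_val_one, Pi.zero_apply, hev f _ v hf,
      hev g _ v hg, mul_eq_zero, hcL, false_or] at h1 h2
    ext i
    fin_cases i
    exacts [h1, h2]
  · have hle : ∀ {q : O[X]}, q.natDegree ≤ Mor.deg Φ →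
        ((q.map (residue O)).map (ResidueField.map (inclusion O w hw))).natDegree ≤ Mor.deg Φ :=
      fun hq => natDegree_map_le.trans (natDegree_map_le.trans hq)
    rw [map_residue_inclusion, map_residue_inclusion, ← Polynomial.homogenize_map,
      ← Polynomial.homogenize_map, chart_std_homogenize (hle hfd), chart_std_homogenize (hle hgd),
      ← wr_map]
    exact (Polynomial.map_ne_zero_iff (RingHom.injective _)).mpr (wr_ne_zero_of_isSeparable hsep)
  · rw [mem_ramificationSet_iff, hform f _ hf, hform g _ hg, isRam_C_mul _ _ hcL]
    rfl
  · rw [map_mk, Projectivization.mk_eq_mk_iff']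
    refine ⟨(algebraMap K L c)⁻¹, ?_⟩
    ext i
    fin_cases i
    · simp [hev f _ v hf, hcL, Mor.formF]
    · simp [hev g _ v hg, hcL, Mor.formG]

end Model

end ProjLine

end

theorem mainTheorem1 {K : Type*} [Field K] [NumberField K]
    {Kbar : Type*} [Field Kbar] [Algebra K Kbar] [IsAlgClosure K Kbar]
    (v : IsDedekindDomain.HeightOneSpectrum (NumberField.RingOfIntegers K))
    (w : ValuationSubring Kbar) (hw : w.comap (algebraMap K Kbar) = ProjLine.valuationRing v)
    (Φ : ProjLine.Mor K) (hdeg : 2 ≤ ProjLine.Mor.deg Φ)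
    (hsep : ProjLine.Mor.IsSeparable (ProjLine.Mor.reduce (ProjLine.valuationRing v) Φ)) :
    ProjLine.Mor.CriticallyGoodReduction w Φ ↔
      (ProjLine.Mor.SimpleGoodReduction (ProjLine.valuationRing v) Φ ∧
        ProjLine.NonsingularMod w (ProjLine.Mor.branchSet Kbar Φ)) := by
  have : IsAlgClosed Kbar := IsAlgClosure.isAlgClosed K
  have : CharZero Kbar := charZero_of_injective_algebraMap (algebraMap K Kbar).injective
  have := ProjLine.isLocalHom_inclusion _ w hw
  have hred := (ProjLine.exists_isReducedForm (ProjLine.valuationRing v) Φ).choose_spec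
  have hmodel := ProjLine.isModel_of_isReducedForm _ w hw hred hsep
  have hle := ProjLine.natDegree_le_of_isReducedForm _ hred
  -- The degree is computed over k(v), while common zeros are sought over the residue field of w.
  have hgood := ProjLine.deg_ofPair_eq_iff
    (IsLocalRing.ResidueField.map (ProjLine.inclusion _ w hw))
    (Polynomial.natDegree_map_le.trans hle.1) (Polynomial.natDegree_map_le.trans hle.2) hsep
  have key := hmodel.nonsingularMod_iff
  rw [ProjLine.map_residue_inclusion, ProjLine.map_residue_inclusion, ← hgood] at key
  exact key
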